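/- Let $G=(V,E)$ be a finite simple graph with $n$ vertices, $m$ edges and maximum degree $\Delta\ge 1$. Consider the following randomized algorithm. (1) Choose a permutation $\pi:E\to\{1,\dots,m\}$ uniformly at random. (2) Let $L\subseteq E$ contain each edge independently with probability $p=\Delta^{-0.85}$. (3) Let $k$ be $\Delta^{0.1}$ rounded up or down to an integer, and let every vertex choose independently and uniformly one of the parts $V_1,\dots,V_k$. (4) Machine $i\in\{1,\dots,k\}$ receives the graph $G^L[V_i]$, that is, the vertices of $V_i$ and the edges of $L$ with both endpoints in $V_i$ (with their ranks in $\pi$), and computes its greedy matching $M_i$: it processes these edges in the order of $\pi$ and adds an edge to $M_i$ if it shares no endpoint with an edge added before. (5) Return $M=\bigcup_{i=1}^k M_i$. The three random choices are independent. Space is counted in words, a word holding a vertex name, the index of a part, or the rank of an edge. The space of machine $i$ is the space needed to store $V_i$, the edges of $G^L[V_i]$ with their ranks, and $M_i$. The total space (aside from storing the input graph $G$) is the sum of the space of the $k$ machines and of the space needed to store the part of every vertex and the edges of $L$ with their ranks. For a vertex $v$, let $\deg_M^{\mathrm{res}}(v)$ be $0$ if $v$ is an endpoint of an edge of $M$,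 and otherwise the number of neighbours of $v$ in $G$ that are not endpoints of edges of $M$. There are absolute constants $c>0$, $C>0$ and $\Delta_0$ such that for every such $G$: 1. if $\Delta\ge\Delta_0$, then with probability at least $1-e^{-n^{c}}$ every machine uses at most $n/\Delta^{c}$ space; 2. with probability at least $1-e^{-n^{c}}$ the total space is at most $Cn+m/\Delta^{c}$; 3. the expected number of vertices $v\in V$ with $\deg_M^{\mathrm{res}}(v)>\Delta^{0.99}$ is at most $C\,n/\Delta^{0.03}$. -/

import Mathlib

namespace NearMaximal

noncomputable section

/-! ### Sequential greedy matching and residual degrees -/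

/-- Greedy maximal matching: go through the edges in the order of the list and add an edge iff it
shares no endpoint with an edge that was added before. -/
def greedyMatching {V : Type*} [DecidableEq V] (order : List (Sym2 V)) : Finset (Sym2 V) :=
  open Classical in
  order.foldl (fun M e => if ∀ f ∈ M, ∀ v : V, ¬ (v ∈ e ∧ v ∈ f) then insert e M else M) ∅

/-- The vertex `v` is covered by the edge set `M`. -/
def Covered {V : Type*} (M : Finset (Sym2 V)) (v : V) : Prop := ∃ e ∈ M, v ∈ e

/-- Residual degree of `v`: zero if `v` is matched, and otherwise the degree of `v` in the subgraph
of `G` induced on the unmatched vertices. -/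
def resDegree {V : Type*} [Fintype V] (G : SimpleGraph V) (M : Finset (Sym2 V)) (v : V) : ℕ :=
  open Classical in
  if Covered M v then 0 else (Finset.univ.filter fun u => G.Adj v u ∧ ¬ Covered M u).card

section Algorithm

variable {V : Type*} [Fintype V] [DecidableEq V] (G : SimpleGraph V) [DecidableRel G.Adj] (k : ℕ)

/-! ### The random choices of the algorithm -/

/-- The random choices: a permutation `π : E → {0, …, m-1}` of the edges, the set `L` of sampled
edges, and the part `χ v` of each vertex `v`. -/
abbrev Outcome : Type _ :=
  (G.edgeSet ≃ Fin (Fintype.card G.edgeSet)) × Finset G.edgeSet × (V → Fin k)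

/-- Edge-sampling probability `p = Δ^(-0.85)`. -/
def sampleProb : ℝ := (G.maxDegree : ℝ) ^ (-0.85 : ℝ)

/-- Probability that `L` is the set of sampled edges. -/
def sampleWeight (L : Finset G.edgeSet) : ℝ :=
  ∏ e : G.edgeSet, if e ∈ L then sampleProb G else 1 - sampleProb G

/-- Probability of a single outcome: `π` is uniform among the `m!` permutations, every edge is in
`L` independently with probability `p`, every vertex picks one of the `k` parts independently and
uniformly, and these three choices are independent of each other. -/
def weight (ω : Outcome G k) : ℝ :=
  (1 / (Nat.factorial (Fintype.card G.edgeSet) : ℝ)) *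
    sampleWeight G ω.2.1 *
    ∏ _v : V, (1 / (k : ℝ))

/-- Probability of an event. -/
def prob (A : Outcome G k → Prop) : ℝ :=
  open Classical in ∑ ω : Outcome G k, if A ω then weight G k ω else 0

/-- Expectation of a real random variable. -/
def expectation (f : Outcome G k → ℝ) : ℝ :=
  ∑ ω : Outcome G k, weight G k ω * f ω

/-! ### The algorithm -/

variable {G k}

/-- The part `V_i`. -/
def partVerts (ω : Outcome G k) (i : Fin k) : Finset V :=
  Finset.univ.filter fun v => ω.2.2 v = i

/-- The edges of `G^L[V_i]`: sampled edges with both endpoints in `V_i`. -/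
def partEdges (ω : Outcome G k) (i : Fin k) : Finset G.edgeSet :=
  open Classical in ω.2.1.filter fun e => ∀ v ∈ (e : Sym2 V), ω.2.2 v = i

/-- The edges of `G^L[V_i]` listed in the order of `π`. -/
def orderedPartEdges (ω : Outcome G k) (i : Fin k) : List (Sym2 V) :=
  ((List.ofFn fun j => ω.1.symm j).filter fun e => e ∈ partEdges ω i).map Subtype.val

/-- The greedy matching `M_i` computed by machine `i`. -/
def partMatching (ω : Outcome G k) (i : Fin k) : Finset (Sym2 V) :=
  greedyMatching (orderedPartEdges ω i)

/-- The output `M = ⋃ M_i`. -/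
def outputMatching (ω : Outcome G k) : Finset (Sym2 V) :=
  Finset.univ.biUnion fun i => partMatching ω i

/-- The number of vertices whose residual degree with respect to the output exceeds `Δ^0.99`. -/
def highResDegreeCount (ω : Outcome G k) : ℕ :=
  open Classical in
  (Finset.univ.filter fun v : V =>
    (G.maxDegree : ℝ) ^ (0.99 : ℝ) < (resDegree G (outputMatching ω) v : ℝ)).card

/-! ### Space, in words

A word holds the name of a vertex, the index of a part, or the rank of an edge. -/

/-- The data records that the algorithm stores. -/
inductive Datum (V : Type*) where
  /-- the name of a vertex -/
  | vertex (v : V)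
  /-- a vertex together with the index of its part -/
  | partOf (v : V) (i : ℕ)
  /-- an edge together with its rank in the permutation -/
  | rankedEdge (e : Sym2 V) (r : ℕ)
  /-- an edge of the computed matching -/
  | matchedEdge (e : Sym2 V)

/-- The number of words a record occupies. -/
def Datum.words {V : Type*} : Datum V → ℕ
  | .vertex _ => 1
  | .partOf _ _ => 2
  | .rankedEdge _ _ => 3
  | .matchedEdge _ => 2

/-- The number of words occupied by a collection of records. -/
def wordsOf {V : Type*} (D : Multiset (Datum V)) : ℕ := (D.map Datum.words).sum

/-- The data that machine `i` receives: the graph `G^L[V_i]` with the ranks of its edges. -/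
def received (ω : Outcome G k) (i : Fin k) : Multiset (Datum V) :=
  (partVerts ω i).val.map Datum.vertex +
    (partEdges ω i).val.map fun e : G.edgeSet => Datum.rankedEdge (e : Sym2 V) (ω.1 e : ℕ)

/-- The memory of machine `i` when it has computed `M_i`. Nothing is deleted before, so this is its
peak memory; the messages it receives and sends are contained in it. -/
def machineMemory (ω : Outcome G k) (i : Fin k) : Multiset (Datum V) :=
  received ω i + (partMatching ω i).val.map Datum.matchedEdge

/-- Space used by machine `i`. -/
def machineSpace (ω : Outcome G k) (i : Fin k) : ℕ := wordsOf (machineMemory ω i)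

/-- The results of the sampling and partitioning steps, stored across the system in addition to the
input graph: the part of every vertex, and the sampled edges with their ranks. -/
def randomizationData (ω : Outcome G k) : Multiset (Datum V) :=
  (Finset.univ : Finset V).val.map (fun v => Datum.partOf v (ω.2.2 v : ℕ)) +
    ω.2.1.val.map fun e : G.edgeSet => Datum.rankedEdge (e : Sym2 V) (ω.1 e : ℕ)

/-- Total space used, aside from the storage of the input graph. -/
def totalSpace (ω : Outcome G k) : ℕ :=
  wordsOf (randomizationData ω) + ∑ i : Fin k, machineSpace ω i

end Algorithm

end

end NearMaximal

open NearMaximal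

/-!
Take expectations over `L` and `χ` for a fixed order `π`.

*Residual degrees.* Machine `i` can be run on all of `V` by letting it see only the colour class of
`i`; write `d_i(v)` for the number of neighbours of `v` that its matching leaves free. An unmatched
`v` has residual degree at most `∑ i, d_i(v)`. For its own machine, revealing the edges one at a
time shows that a vertex which stays unmatched sees few free edges, so the mean of `d_{χ v}(v)` is
at most `1 / p`. By symmetry all `d_i(v)` have the same mean, and changing the part of one vertex
changes the set of vertices matched by machine `i` by at most one vertex, so the Efron-Stein
inequality bounds the variance summed over `v` by `n Δ` up to a constant. Chebyshev's inequality
then compares `∑ i, d_i(v)` with `k d_{χ v}(v)`.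

*Space.* The space of a machine is dominated by a polynomial with nonnegative coefficients in
independent indicators, whose exponential moment is that of its mean up to a factor `2` per
variable, provided that at each vertex the coefficients sum to at most `1`. Markov's inequality
finishes the argument.
-/

namespace NearMaximal

open Finset Function
open scoped BigOperators

noncomputable section

section EfronStein

variable {ι : Type*} {α : ι → Type*} [DecidableEq ι] [∀ i, Fintype (α i)]

/-- The average of `f` over its `w`-th coordinate, that is, its conditional expectation given the
other coordinates under the uniform distribution on the product. It is a function on the whole
product which does not depend on the coordinate `w`. -/
def avgAt (w : ι) (f : (∀ i, α i) → ℝ) (χ : ∀ i, α i) : ℝ := 𝔼 j, f (update χ w j)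

lemma avgAt_update (w : ι) (f : (∀ i, α i) → ℝ) (χ : ∀ i, α i) (j : α w) :
    avgAt w f (update χ w j) = avgAt w f χ := by
  simp only [avgAt, update_idem]

lemma avgAt_mul_avgAt (w : ι) (f g : (∀ i, α i) → ℝ) (χ : ∀ i, α i) :
    avgAt w (fun χ => f χ * avgAt w g χ) χ = avgAt w f χ * avgAt w g χ := by
  rw [avgAt]
  simp_rw [avgAt_update, ← expect_mul]
  rfl

lemma avgAt_sub (w : ι) (f g : (∀ i, α i) → ℝ) (χ : ∀ i, α i) :
    avgAt w (fun χ => f χ - g χ) χ = avgAt w f χ - avgAt w g χ :=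
  expect_sub_distrib _ _ _

lemma sq_sub_avgAt_le (w : ι) [Nonempty (α w)] (f : (∀ i, α i) → ℝ) (χ : ∀ i, α i) :
    (f χ - avgAt w f χ) ^ 2 ≤ 𝔼 j, (f χ - f (update χ w j)) ^ 2 := by
  have jensen := expect_mul_sq_le_sq_mul_sq univ (fun j => f χ - f (update χ w j)) fun _ => 1
  simpa only [mul_one, one_pow, Fintype.expect_const, expect_sub_distrib, avgAt] using jensen

/-- The average of `f` over the coordinates in a list. -/
def avgOver (l : List ι) (f : (∀ i, α i) → ℝ) : (∀ i, α i) → ℝ := l.foldr avgAt f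

lemma avgOver_congr {f : (∀ i, α i) → ℝ} {l : List ι} {χ χ' : ∀ i, α i}
    (h : ∀ i, i ∉ l → χ i = χ' i) : avgOver l f χ = avgOver l f χ' := by
  induction l generalizing χ χ' with
  | nil => rw [funext fun i => h i List.not_mem_nil]
  | cons w l ih =>
    refine expect_congr rfl fun j _ => ih fun i hi => ?_
    obtain rfl | hiw := eq_or_ne i w
    · simp only [update_self]
    · rw [update_of_ne hiw, update_of_ne hiw, h i (List.not_mem_cons_of_ne_of_not_mem hiw hi)]

variable [Fintype ι] [∀ i, Nonempty (α i)]

lemma expect_avgAt (w : ι) (f : (∀ i, α i) → ℝ) : 𝔼 χ, avgAt w f χ = 𝔼 χ, f χ := by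
  have resample_involutive : Involutive
      fun x : (∀ i, α i) × α w => (update x.1 w x.2, x.1 w) := fun x => by simp
  calc 𝔼 χ, avgAt w f χ
      = 𝔼 x : (∀ i, α i) × α w, f (update x.1 w x.2) := by
        simp only [avgAt, ← univ_product_univ, expect_product]
    _ = 𝔼 x : (∀ i, α i) × α w, f x.1 :=
        Fintype.expect_equiv resample_involutive.toPerm _ _ fun _ => rfl
    _ = 𝔼 χ, f χ := by
        rw [← univ_product_univ, expect_product]
        simp only [Fintype.expect_const]

lemma expect_mul_avgAt (w : ι) (f g : (∀ i, α i) → ℝ) :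
    𝔼 χ, f χ * avgAt w g χ = 𝔼 χ, avgAt w f χ * avgAt w g χ := by
  rw [← expect_avgAt w]
  simp_rw [avgAt_mul_avgAt]

lemma expect_sq_sub_avgAt_add_avgAt (w : ι) (f g : (∀ i, α i) → ℝ) :
    𝔼 χ, (f χ - avgAt w f χ + avgAt w g χ) ^ 2 =
      𝔼 χ, (f χ - avgAt w f χ) ^ 2 + 𝔼 χ, avgAt w g χ ^ 2 := by
  have expand (χ) : (f χ - avgAt w f χ + avgAt w g χ) ^ 2 =
      (f χ - avgAt w f χ) ^ 2 + avgAt w g χ ^ 2 +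
        2 * (f χ * avgAt w g χ - avgAt w f χ * avgAt w g χ) := by ring
  simp_rw [expand, expect_add_distrib, ← mul_expect, expect_sub_distrib, expect_mul_avgAt w f g]
  ring

lemma expect_avgAt_sq_le (w : ι) (f : (∀ i, α i) → ℝ) :
    𝔼 χ, avgAt w f χ ^ 2 ≤ 𝔼 χ, f χ ^ 2 := by
  have pythagoras := expect_sq_sub_avgAt_add_avgAt w f f
  simp only [sub_add_cancel] at pythagoras
  rw [pythagoras]
  exact le_add_of_nonneg_left (expect_nonneg fun _ _ => sq_nonneg _)

lemma expect_avgOver (l : List ι) (f : (∀ i, α i) → ℝ) : 𝔼 χ, avgOver l f χ = 𝔼 χ, f χ := by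
  induction l with
  | nil => rfl
  | cons w l ih => exact (expect_avgAt w _).trans ih

lemma expect_sq_sub_avgOver_le (l : List ι) (f : (∀ i, α i) → ℝ) :
    𝔼 χ, (f χ - avgOver l f χ) ^ 2 ≤ (l.map fun w => 𝔼 χ, (f χ - avgAt w f χ) ^ 2).sum := by
  induction l with
  | nil => simp [avgOver]
  | cons w l ih =>
    have split (χ) : f χ - avgOver (w :: l) f χ =
        f χ - avgAt w f χ + avgAt w (fun χ => f χ - avgOver l f χ) χ := by
      rw [avgAt_sub]
      exact (sub_add_sub_cancel _ _ _).symm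
    simp_rw [split, List.map_cons, List.sum_cons, expect_sq_sub_avgAt_add_avgAt]
    gcongr
    exact (expect_avgAt_sq_le w _).trans ih

lemma avgOver_univ (f : (∀ i, α i) → ℝ) (χ : ∀ i, α i) :
    avgOver univ.toList f χ = 𝔼 χ', f χ' := by
  rw [← expect_avgOver univ.toList f, ← Fintype.expect_const (ι := ∀ i, α i) (avgOver _ f χ)]
  exact expect_congr rfl fun _ _ => avgOver_congr fun i hi => absurd (mem_toList.2 (mem_univ i)) hi

theorem efronStein (f : (∀ i, α i) → ℝ) :
    𝔼 χ, (f χ - 𝔼 χ', f χ') ^ 2 ≤ ∑ w, 𝔼 χ, (f χ - avgAt w f χ) ^ 2 := by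
  simpa only [avgOver_univ, sum_map_toList] using expect_sq_sub_avgOver_le univ.toList f

theorem sum_expect_sq_sub_expect_le {κ : Type*} [Fintype κ] {f : κ → (∀ i, α i) → ℝ} {D : ℝ}
    (hf : ∀ χ w j, ∑ a, (f a χ - f a (update χ w j)) ^ 2 ≤ D) :
    ∑ a, 𝔼 χ, (f a χ - 𝔼 χ', f a χ') ^ 2 ≤ Fintype.card ι * D :=
  calc ∑ a, 𝔼 χ, (f a χ - 𝔼 χ', f a χ') ^ 2
      ≤ ∑ a, ∑ w, 𝔼 χ, 𝔼 j, (f a χ - f a (update χ w j)) ^ 2 :=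
        sum_le_sum fun a _ => (efronStein (f a)).trans <|
          sum_le_sum fun w _ => expect_le_expect fun χ _ => sq_sub_avgAt_le w (f a) χ
    _ = ∑ w, 𝔼 χ, 𝔼 j, ∑ a, (f a χ - f a (update χ w j)) ^ 2 := by
        rw [sum_comm]
        simp_rw [expect_sum_comm]
    _ ≤ ∑ _w : ι, D := sum_le_sum fun w _ => expect_le univ_nonempty fun χ _ =>
        expect_le univ_nonempty fun j _ => hf χ w j
    _ = Fintype.card ι * D := by rw [sum_const, card_univ, nsmul_eq_mul]

end EfronStein

section ExponentialMoment

lemma exp_le_one_add_two_mul {x : ℝ} (h0 : 0 ≤ x) (h1 : x ≤ 1) : Real.exp x ≤ 1 + 2 * x := by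
  have h := Real.abs_exp_sub_one_le (by rwa [abs_of_nonneg h0] : |x| ≤ 1)
  rw [abs_of_nonneg h0] at h
  linarith [le_abs_self (Real.exp x - 1)]

lemma expect_exp_mul_le {α : Type*} [Fintype α] [Nonempty α] {X : α → ℝ}
    (hX : ∀ j, X j ∈ Set.Icc 0 1) {D : ℝ} (hD : D ∈ Set.Icc 0 1) :
    𝔼 j, Real.exp (X j * D) ≤ Real.exp (2 * (𝔼 j, X j) * D) :=
  calc 𝔼 j, Real.exp (X j * D)
      ≤ 𝔼 j, (1 + 2 * (X j * D)) := expect_le_expect fun j _ =>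
        exp_le_one_add_two_mul (mul_nonneg (hX j).1 hD.1) (mul_le_one₀ (hX j).2 hD.1 hD.2)
    _ = 2 * (𝔼 j, X j) * D + 1 := by
        rw [expect_add_distrib, Fintype.expect_const, ← mul_expect, ← expect_mul]
        ring
    _ ≤ Real.exp (2 * (𝔼 j, X j) * D) := Real.add_one_le_exp _

variable {ι κ : Type*} [DecidableEq ι] [Fintype κ] {a : κ → ℝ} {S : κ → Finset ι}

lemma sum_mul_prod_update (a : κ → ℝ) (S : κ → Finset ι) (x : ι → ℝ) (w : ι) (t : ℝ) :
    ∑ i, a i * ∏ v ∈ S i, update x w t v =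
      ∑ i with w ∉ S i, a i * ∏ v ∈ S i, x v +
        t * ∑ i with w ∈ S i, a i * ∏ v ∈ S i \ {w}, x v := by
  rw [add_comm, ← sum_filter_add_sum_filter_not univ fun i => w ∈ S i, mul_sum]
  congr 1 <;> refine sum_congr rfl fun i hi => ?_
  · rw [prod_update_of_mem (mem_filter.1 hi).2, mul_left_comm]
  · rw [prod_update_of_notMem (mem_filter.1 hi).2]

lemma sum_mul_prod_sdiff_mem_Icc (ha : ∀ i, 0 ≤ a i) {w : ι} (hw : ∑ i with w ∈ S i, a i ≤ 1)
    {x : ι → ℝ} (hx : ∀ v, x v ∈ Set.Icc 0 1) :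
    ∑ i with w ∈ S i, a i * ∏ v ∈ S i \ {w}, x v ∈ Set.Icc 0 1 :=
  ⟨sum_nonneg fun i _ => mul_nonneg (ha i) (prod_nonneg fun v _ => (hx v).1),
    (sum_le_sum fun i _ => mul_le_of_le_one_right (ha i)
      (prod_le_one (fun v _ => (hx v).1) fun v _ => (hx v).2)).trans hw⟩

lemma expect_exp_sum_mul_prod_update_le (ha : ∀ i, 0 ≤ a i) {w : ι}
    (hw : ∑ i with w ∈ S i, a i ≤ 1) {x : ι → ℝ} (hx : ∀ v, x v ∈ Set.Icc 0 1)
    {α : Type*} [Fintype α] [Nonempty α] {X : α → ℝ} (hX : ∀ j, X j ∈ Set.Icc 0 1) :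
    𝔼 j, Real.exp (∑ i, a i * ∏ v ∈ S i, update x w (X j) v) ≤
      Real.exp (∑ i, a i * ∏ v ∈ S i, update x w (2 * 𝔼 j, X j) v) := by
  simp_rw [sum_mul_prod_update, Real.exp_add, ← mul_expect]
  gcongr
  exact expect_exp_mul_le hX (sum_mul_prod_sdiff_mem_Icc ha hw hx)

/-- The independent variables `X v` are replaced by the constants `2 * 𝔼 X v` one at a time. -/
theorem expect_exp_sum_mul_prod_le [Fintype ι] (ha : ∀ i, 0 ≤ a i)
    (hS : ∀ w, ∑ i with w ∈ S i, a i ≤ 1)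
    {α : ι → Type*} [∀ v, Fintype (α v)] [∀ v, Nonempty (α v)] {X : ∀ v, α v → ℝ}
    (hX : ∀ v j, X v j ∈ Set.Icc 0 1) (hX2 : ∀ v, 2 * 𝔼 j, X v j ≤ 1) :
    𝔼 χ : ∀ v, α v, Real.exp (∑ i, a i * ∏ v ∈ S i, X v (χ v)) ≤
      Real.exp (∑ i, a i * ∏ v ∈ S i, (2 * 𝔼 j, X v j)) := by
  let mixed (R : Finset ι) (χ : ∀ v, α v) (v : ι) : ℝ :=
    if v ∈ R then 2 * 𝔼 j, X v j else X v (χ v)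
  have mixed_mem (R χ v) : mixed R χ v ∈ Set.Icc 0 1 := by
    simp only [mixed]
    split_ifs
    · exact ⟨mul_nonneg zero_le_two (expect_nonneg fun j _ => (hX v j).1), hX2 v⟩
    · exact hX v _
  have replace (R : Finset ι) : 𝔼 χ : ∀ v, α v, Real.exp (∑ i, a i * ∏ v ∈ S i, X v (χ v)) ≤
      𝔼 χ : ∀ v, α v, Real.exp (∑ i, a i * ∏ v ∈ S i, mixed R χ v) := by
    induction R using Finset.induction_on with
    | empty => simp [mixed]
    | insert w R hw ih =>
      refine ih.trans ?_
      rw [← expect_avgAt w]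
      refine expect_le_expect fun χ _ => ?_
      have mixed_update (j) :
          mixed R (update χ w j) = update (mixed (insert w R) χ) w (X w j) := by
        ext v
        obtain rfl | hv := eq_or_ne v w <;> simp [mixed, *]
      have update_mixed :
          update (mixed (insert w R) χ) w (2 * 𝔼 j, X w j) = mixed (insert w R) χ :=
        update_eq_self_iff.2 (by simp [mixed])
      have step := expect_exp_sum_mul_prod_update_le ha (hS w) (mixed_mem (insert w R) χ) (hX w)
      rw [update_mixed] at step
      simpa only [avgAt, mixed_update] using step
  simpa [mixed] using replace univ

end ExponentialMoment

section BernoulliSubset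

variable {ε : Type*} [Fintype ε] [DecidableEq ε] {p : ℝ}

/-- The probability that `L` is the random subset of `ε` that contains each element independently
with probability `p`. -/
def bernoulliWeight (p : ℝ) (L : Finset ε) : ℝ := ∏ e, if e ∈ L then p else 1 - p

/-- The expectation of `f` at a random subset of `ε` that contains each element independently with
probability `p`. -/
def sampleExpect (p : ℝ) (f : Finset ε → ℝ) : ℝ := ∑ L, bernoulliWeight p L * f L

lemma bernoulliWeight_nonneg (hp : p ∈ Set.Icc 0 1) (L : Finset ε) : 0 ≤ bernoulliWeight p L :=
  prod_nonneg fun e _ => by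
    split_ifs
    · exact hp.1
    · exact sub_nonneg.2 hp.2

lemma bernoulliWeight_insert {L : Finset ε} {e : ε} (he : e ∉ L) :
    (1 - p) * bernoulliWeight p (insert e L) = p * bernoulliWeight p L := by
  have agree : ∏ x ∈ univ.erase e, (if x ∈ insert e L then p else 1 - p) =
      ∏ x ∈ univ.erase e, (if x ∈ L then p else 1 - p) :=
    prod_congr rfl fun x hx => by simp [ne_of_mem_erase hx]
  rw [bernoulliWeight, bernoulliWeight, ← mul_prod_erase univ _ (mem_univ e),
    ← mul_prod_erase univ (fun x => if x ∈ L then _ else _) (mem_univ e), agree,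
    if_pos (mem_insert_self e L), if_neg he, mul_left_comm]

lemma mul_bernoulliWeight_le_insert (hp : p ∈ Set.Icc 0 1) {L : Finset ε} {e : ε} (he : e ∉ L) :
    p * bernoulliWeight p L ≤ bernoulliWeight p (insert e L) := by
  rw [← bernoulliWeight_insert he]
  exact mul_le_of_le_one_left (bernoulliWeight_nonneg hp _) (sub_le_self 1 hp.1)

lemma sampleExpect_prod (p : ℝ) (z : ε → ℝ) :
    sampleExpect p (fun L => ∏ e ∈ L, z e) = ∏ e, (p * z e + (1 - p)) := by
  rw [sampleExpect, prod_add, powerset_univ]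
  refine sum_congr rfl fun L _ => ?_
  rw [bernoulliWeight, prod_ite, filter_mem_eq_inter, univ_inter, filter_notMem_eq_sdiff,
    prod_mul_distrib, mul_right_comm]

lemma sampleExpect_const (p c : ℝ) : sampleExpect p (fun _ : Finset ε => c) = c := by
  have total := sampleExpect_prod (ε := ε) p fun _ => 1
  simp only [prod_const_one, mul_one, add_sub_cancel] at total
  rw [sampleExpect, ← sum_mul]
  simpa only [sampleExpect, mul_one, one_mul] using congrArg (· * c) total

lemma sampleExpect_const_mul (p c : ℝ) (f : Finset ε → ℝ) :
    sampleExpect p (fun L => c * f L) = c * sampleExpect p f := by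
  simp only [sampleExpect, mul_sum, mul_left_comm]

lemma sampleExpect_mono (hp : p ∈ Set.Icc 0 1) {f g : Finset ε → ℝ} (h : ∀ L, f L ≤ g L) :
    sampleExpect p f ≤ sampleExpect p g :=
  sum_le_sum fun L _ => mul_le_mul_of_nonneg_left (h L) (bernoulliWeight_nonneg hp L)

lemma sampleExpect_le (hp : p ∈ Set.Icc 0 1) {f : Finset ε → ℝ} {c : ℝ} (h : ∀ L, f L ≤ c) :
    sampleExpect p f ≤ c :=
  (sampleExpect_mono hp h).trans_eq (sampleExpect_const p c)

lemma sampleExpect_expect_comm {κ : Type*} [Fintype κ] (p : ℝ) (f : Finset ε → κ → ℝ) :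
    sampleExpect p (fun L => 𝔼 a, f L a) = 𝔼 a, sampleExpect p fun L => f L a := by
  simp only [sampleExpect, mul_expect, expect_sum_comm]

lemma sampleExpect_exp_sum_le (hp : p ∈ Set.Icc 0 1) {z : ε → ℝ} (hz : ∀ e, z e ∈ Set.Icc 0 1) :
    sampleExpect p (fun L => Real.exp (∑ e ∈ L, z e)) ≤ Real.exp (2 * p * ∑ e, z e) := by
  simp_rw [Real.exp_sum, sampleExpect_prod, mul_sum, Real.exp_sum]
  refine prod_le_prod (fun e _ => ?_) fun e _ => ?_
  · exact add_nonneg (mul_nonneg hp.1 (Real.exp_pos _).le) (sub_nonneg.2 hp.2)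
  · calc p * Real.exp (z e) + (1 - p)
        ≤ p * (1 + 2 * z e) + (1 - p) := by
          gcongr
          exacts [hp.1, exp_le_one_add_two_mul (hz e).1 (hz e).2]
      _ = 2 * p * z e + 1 := by ring
      _ ≤ Real.exp (2 * p * z e) := Real.add_one_le_exp _

lemma mul_sum_bernoulliWeight_le (hp : p ∈ Set.Icc 0 1) {e : ε} {P Q : Finset ε → Prop}
    [DecidablePred P] [DecidablePred Q] (h : ∀ L, P L → e ∉ L ∧ Q (insert e L)) :
    p * ∑ L with P L, bernoulliWeight p L ≤ ∑ L with Q L, bernoulliWeight p L := by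
  have insert_injOn : Set.InjOn (insert e) (({L | P L} : Finset (Finset ε)) : Set (Finset ε)) :=
    fun L hL L' hL' hLL' => by
      rw [← erase_insert (h L (mem_filter.1 hL).2).1, hLL',
        erase_insert (h L' (mem_filter.1 hL').2).1]
  calc p * ∑ L with P L, bernoulliWeight p L
      ≤ ∑ L with P L, bernoulliWeight p (insert e L) := by
        rw [mul_sum]
        exact sum_le_sum fun L hL => mul_bernoulliWeight_le_insert hp (h L (mem_filter.1 hL).2).1
    _ = ∑ L ∈ ({L | P L} : Finset (Finset ε)).image (insert e), bernoulliWeight p L :=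
        (sum_image insert_injOn).symm
    _ ≤ ∑ L with Q L, bernoulliWeight p L := by
        refine sum_le_sum_of_subset_of_nonneg (image_subset_iff.2 fun L hL => ?_)
          fun L _ _ => bernoulliWeight_nonneg hp L
        exact mem_filter.2 ⟨mem_univ _, (h L (mem_filter.1 hL).2).2⟩

lemma sampleExpect_card (p : ℝ) (P : Finset ε → ε → Prop) [∀ L e, Decidable (P L e)] :
    sampleExpect p (fun L => (#{e | P L e} : ℝ)) = ∑ e, ∑ L with P L e, bernoulliWeight p L := by
  simp_rw [sampleExpect, ← sum_boole, mul_sum, mul_boole]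
  rw [sum_comm]
  simp_rw [sum_filter]

theorem mul_sampleExpect_card_le (hp : p ∈ Set.Icc 0 1) {P Q : Finset ε → ε → Prop}
    [∀ L e, Decidable (P L e)] [∀ L e, Decidable (Q L e)]
    (h : ∀ L e, P L e → e ∉ L ∧ Q (insert e L) e) :
    p * sampleExpect p (fun L => (#{e | P L e} : ℝ)) ≤
      sampleExpect p (fun L => (#{e | Q L e} : ℝ)) := by
  rw [sampleExpect_card, sampleExpect_card, mul_sum]
  exact sum_le_sum fun e _ => mul_sum_bernoulliWeight_le hp fun L => h L e

end BernoulliSubset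

section Greedy

variable {V : Type*} [DecidableEq V]

/-- The greedy matching of a list of edges, in the order of the list, when the vertices in `A` count
as covered from the start. -/
def greedyAccepted : Finset V → List (Sym2 V) → Finset (Sym2 V)
  | _, [] => ∅
  | A, e :: l =>
    if Disjoint e.toFinset A then insert e (greedyAccepted (A ∪ e.toFinset) l)
    else greedyAccepted A l

/-- The covered vertices after the greedy algorithm has processed the edge `e`, when `A` are those
before. -/
def coverStep (A : Finset V) (e : Sym2 V) : Finset V :=
  if Disjoint e.toFinset A then A ∪ e.toFinset else A

/-- The covered vertices after the greedy algorithm has processed a list of edges, when `A` are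
those before. -/
def greedyCover (A : Finset V) (l : List (Sym2 V)) : Finset V := l.foldl coverStep A

variable {A B : Finset V} {e : Sym2 V} {l : List (Sym2 V)}

lemma subset_coverStep (A : Finset V) (e : Sym2 V) : A ⊆ coverStep A e := by
  unfold coverStep
  split_ifs
  exacts [subset_union_left, Subset.rfl]

lemma not_disjoint_coverStep (A : Finset V) (e : Sym2 V) :
    ¬ Disjoint e.toFinset (coverStep A e) := by
  unfold coverStep
  split_ifs with h
  · have endpoint : e.out.1 ∈ e.toFinset := Sym2.mem_toFinset.2 e.out_fst_mem
    exact not_disjoint_iff.2 ⟨_, endpoint, mem_union_right A endpoint⟩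
  · exact h

lemma subset_greedyCover (A : Finset V) (l : List (Sym2 V)) : A ⊆ greedyCover A l := by
  induction l generalizing A with
  | nil => exact Subset.rfl
  | cons e l ih => exact (subset_coverStep A e).trans (ih _)

lemma not_disjoint_greedyCover (A : Finset V) (he : e ∈ l) :
    ¬ Disjoint e.toFinset (greedyCover A l) := by
  induction l generalizing A with
  | nil => cases he
  | cons f l ih =>
    obtain rfl | he := List.mem_cons.1 he
    · exact fun h => not_disjoint_coverStep A e (h.mono_right (subset_greedyCover _ l))
    · exact ih _ he

lemma greedyAccepted_append (A : Finset V) (l₁ l₂ : List (Sym2 V)) :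
    greedyAccepted A (l₁ ++ l₂) = greedyAccepted A l₁ ∪ greedyAccepted (greedyCover A l₁) l₂ := by
  induction l₁ generalizing A with
  | nil => exact (empty_union _).symm
  | cons e l₁ ih =>
    simp only [List.cons_append, greedyAccepted, greedyCover, List.foldl_cons, coverStep]
    split_ifs
    · rw [ih, insert_union, greedyCover]
    · rw [ih, greedyCover]

lemma greedyCover_eq_union_biUnion (A : Finset V) (l : List (Sym2 V)) :
    greedyCover A l = A ∪ (greedyAccepted A l).biUnion Sym2.toFinset := by
  induction l generalizing A with
  | nil => simp [greedyCover, greedyAccepted]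
  | cons e l ih =>
    have cons : greedyCover A (e :: l) = greedyCover (coverStep A e) l := rfl
    rw [cons, ih, greedyAccepted, coverStep]
    split_ifs
    · rw [biUnion_insert, union_assoc]
    · rfl

lemma mem_greedyAccepted_of_disjoint_greedyCover {l₁ l₂ : List (Sym2 V)}
    (h : Disjoint e.toFinset (greedyCover A (l₁ ++ l₂))) :
    e ∈ greedyAccepted A (l₁ ++ e :: l₂) := by
  have prefix_subset : greedyCover A l₁ ⊆ greedyCover A (l₁ ++ l₂) := by
    rw [greedyCover.eq_def A (l₁ ++ l₂), List.foldl_append]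
    exact subset_greedyCover _ l₂
  rw [greedyAccepted_append, greedyAccepted, if_pos (h.mono_right prefix_subset)]
  exact mem_union_right _ (mem_insert_self _ _)

lemma disjoint_of_mem_greedyAccepted (he : e ∈ greedyAccepted A l) : Disjoint e.toFinset A := by
  induction l generalizing A with
  | nil => simp [greedyAccepted] at he
  | cons f l ih =>
    rw [greedyAccepted] at he
    split_ifs at he with hf
    · obtain rfl | he := mem_insert.1 he
      exacts [hf, (ih he).mono_right subset_union_left]
    · exact ih he

lemma pairwiseDisjoint_greedyAccepted (A : Finset V) (l : List (Sym2 V)) :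
    (greedyAccepted A l : Set (Sym2 V)).PairwiseDisjoint Sym2.toFinset := by
  induction l generalizing A with
  | nil => simp [greedyAccepted]
  | cons e l ih =>
    rw [greedyAccepted]
    split_ifs
    · rw [coe_insert]
      refine (ih _).insert fun f hf _ => ?_
      exact ((disjoint_of_mem_greedyAccepted hf).mono_right subset_union_right).symm
    · exact ih _

lemma mem_of_mem_greedyAccepted (he : e ∈ greedyAccepted A l) : e ∈ l := by
  induction l generalizing A with
  | nil => simp [greedyAccepted] at he
  | cons f l ih =>
    rw [greedyAccepted] at he
    split_ifs at he
    · exact List.mem_cons.2 ((mem_insert.1 he).imp_right ih)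
    · exact List.mem_cons_of_mem _ (ih he)

lemma greedyAccepted_union_eq_filter (A B : Finset V) (l : List (Sym2 V)) :
    greedyAccepted (A ∪ B) l = greedyAccepted A (l.filter (Disjoint ·.toFinset B)) := by
  induction l generalizing A with
  | nil => rfl
  | cons e l ih =>
    by_cases hB : Disjoint e.toFinset B
    · rw [List.filter_cons_of_pos (by simpa using hB)]
      simp only [greedyAccepted, disjoint_union_right, hB, and_true, union_right_comm A B, ih]
    · rw [List.filter_cons_of_neg (by simpa using hB), greedyAccepted,
        if_neg fun h => hB (h.mono_right subset_union_right), ih]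

lemma greedyMatching_eq_greedyAccepted (l : List (Sym2 V)) :
    greedyMatching l = greedyAccepted ∅ l := by
  classical
  suffices foldl_eq : ∀ M : Finset (Sym2 V),
      l.foldl (fun M e => if ∀ f ∈ M, ∀ v, ¬ (v ∈ e ∧ v ∈ f) then insert e M else M) M =
        M ∪ greedyAccepted (M.biUnion Sym2.toFinset) l from
    (foldl_eq ∅).trans (empty_union _)
  intro M
  induction l generalizing M with
  | nil => exact (union_empty M).symm
  | cons e l ih =>
    have avoids_iff : (∀ f ∈ M, ∀ v, ¬ (v ∈ e ∧ v ∈ f)) ↔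
        Disjoint e.toFinset (M.biUnion Sym2.toFinset) := by
      simp only [disjoint_biUnion_right]
      simp only [disjoint_left, Sym2.mem_toFinset, not_and]
    rw [List.foldl_cons, ih, greedyAccepted]
    simp only [avoids_iff]
    split_ifs
    · rw [biUnion_insert, union_comm e.toFinset, insert_union, union_insert]
    · rfl

end Greedy

section DifferAtMostOne

variable {V : Type*}

/-- `A` and `B` agree except possibly on one element. Each step of the greedy algorithm preserves
this relation between two sets of covered vertices. -/
def DifferAtMostOne (A B : Finset V) : Prop := ∃ x, ∀ y ≠ x, (y ∈ A ↔ y ∈ B)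

lemma DifferAtMostOne.symm {A B : Finset V} (h : DifferAtMostOne A B) : DifferAtMostOne B A :=
  h.imp fun _ hx y hy => (hx y hy).symm

variable [DecidableEq V]

lemma DifferAtMostOne.union_left {A B C : Finset V} (h : DifferAtMostOne A B)
    (hA : Disjoint C A) (hB : ¬ Disjoint C B) (hC : #C ≤ 2) : DifferAtMostOne (A ∪ C) B := by
  obtain ⟨x, hx⟩ := h
  obtain ⟨z, hzC, hzB⟩ := not_disjoint_iff.1 hB
  obtain rfl : z = x := by
    by_contra hzx
    exact disjoint_left.1 hA hzC ((hx z hzx).2 hzB)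
  have erase_card : #(C.erase z) ≤ 1 := by
    rw [card_erase_of_mem hzC]
    omega
  have : Nonempty V := ⟨z⟩
  obtain ⟨w, hw⟩ := card_le_one_iff_subset_singleton.1 erase_card
  refine ⟨w, fun y hyw => ?_⟩
  obtain rfl | hyz := eq_or_ne y z
  · simp only [mem_union, hzC, or_true, hzB]
  · have hyC : y ∉ C := fun hy => hyw (mem_singleton.1 (hw (mem_erase.2 ⟨hyz, hy⟩)))
    rw [mem_union, or_iff_left hyC, hx y hyz]

lemma DifferAtMostOne.coverStep {A B : Finset V} (h : DifferAtMostOne A B) (e : Sym2 V) :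
    DifferAtMostOne (coverStep A e) (coverStep B e) := by
  have two_endpoints : #e.toFinset ≤ 2 := by
    rw [Sym2.card_toFinset]
    split_ifs <;> omega
  unfold NearMaximal.coverStep
  split_ifs with hA hB hB
  · exact h.imp fun x hx y hy => by rw [mem_union, mem_union, hx y hy]
  · exact h.union_left hA hB two_endpoints
  · exact (h.symm.union_left hB hA two_endpoints).symm
  · exact h

lemma DifferAtMostOne.greedyCover {A B : Finset V} (h : DifferAtMostOne A B)
    (l : List (Sym2 V)) : DifferAtMostOne (greedyCover A l) (greedyCover B l) := by
  induction l generalizing A B with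
  | nil => exact h
  | cons e _ ih => exact ih (h.coverStep e)

end DifferAtMostOne

section SampledList

variable {V : Type*} {E : Set (Sym2 V)} [DecidableEq E]

/-- The edges in `L`, listed in the order `o`. -/
def sampledList (o : List E) (L : Finset E) : List (Sym2 V) :=
  (o.filter (· ∈ L)).map Subtype.val

lemma mem_sampledList {o : List E} {L : Finset E} {e : E} (ho : e ∈ o) (he : e ∈ L) :
    (e : Sym2 V) ∈ sampledList o L :=
  List.mem_map_of_mem (List.mem_filter.2 ⟨ho, decide_eq_true he⟩)

lemma exists_sampledList_insert {o : List E} (hn : o.Nodup) {e : E} (ho : e ∈ o) {L : Finset E}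
    (he : e ∉ L) : ∃ l₁ l₂, sampledList o L = l₁ ++ l₂ ∧
      sampledList o (insert e L) = l₁ ++ (e : Sym2 V) :: l₂ := by
  obtain ⟨o₁, o₂, rfl⟩ := List.append_of_mem ho
  have e_notMem : e ∉ o₁ ++ o₂ := (List.nodup_cons.1 (List.nodup_middle.1 hn)).1
  have filter_insert {o' : List E} (h : e ∉ o') :
      o'.filter (· ∈ insert e L) = o'.filter (· ∈ L) :=
    List.filter_congr fun f hf => by simp [ne_of_mem_of_not_mem hf h]
  rw [List.mem_append, not_or] at e_notMem
  refine ⟨sampledList o₁ L, sampledList o₂ L, ?_, ?_⟩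
  · simp [sampledList, List.filter_append, he]
  · rw [sampledList, List.filter_append, filter_insert e_notMem.1,
      List.filter_cons_of_pos (by simp), filter_insert e_notMem.2,
      List.map_append, List.map_cons]
    rfl

end SampledList

section FreeDegree

variable {V : Type*} [Fintype V] [DecidableEq V] (G : SimpleGraph V) [DecidableRel G.Adj]

/-- The number of neighbours of `v` outside a set `A` of covered vertices. -/
def freeDegree (A : Finset V) (v : V) : ℕ := #{u | G.Adj v u ∧ u ∉ A}

variable {G}

lemma freeDegree_le_add {A B : Finset V} {x : V} (h : ∀ y ≠ x, (y ∈ A ↔ y ∈ B)) (v : V) :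
    freeDegree G A v ≤ freeDegree G B v + if G.Adj x v then 1 else 0 := by
  have subset_union : ({u | G.Adj v u ∧ u ∉ A} : Finset V) ⊆
      ({u | G.Adj v u ∧ u ∉ B} : Finset V) ∪ {u ∈ ({x} : Finset V) | G.Adj u v} := fun u hu => by
    obtain ⟨hvu, huA⟩ := (mem_filter.1 hu).2
    obtain rfl | hux := eq_or_ne u x
    · exact mem_union_right _ (mem_filter.2 ⟨mem_singleton_self u, hvu.symm⟩)
    · exact mem_union_left _ (mem_filter.2 ⟨mem_univ u, hvu, (h u hux).not.1 huA⟩)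
  rw [← sum_singleton (fun u => if G.Adj u v then 1 else 0) x, ← card_filter]
  exact (card_le_card subset_union).trans (card_union_le _ _)

lemma sum_sq_freeDegree_sub_le {A B : Finset V} (h : DifferAtMostOne A B) :
    ∑ v, ((freeDegree G A v : ℝ) - freeDegree G B v) ^ 2 ≤ G.maxDegree := by
  obtain ⟨x, hx⟩ := h
  have sq_le (v : V) :
      ((freeDegree G A v : ℝ) - freeDegree G B v) ^ 2 ≤ if G.Adj x v then 1 else 0 := by
    have hAB := freeDegree_le_add (G := G) hx v
    have hBA := freeDegree_le_add (G := G) (fun y hy => (hx y hy).symm) v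
    split_ifs at * with hvx
    · rw [sq_le_one_iff_abs_le_one, abs_le]
      constructor <;> linarith [(mod_cast hAB : (freeDegree G A v : ℝ) ≤ freeDegree G B v + 1),
        (mod_cast hBA : (freeDegree G B v : ℝ) ≤ freeDegree G A v + 1)]
    · rw [show freeDegree G A v = freeDegree G B v from le_antisymm hAB hBA, sub_self,
        zero_pow two_ne_zero]
  calc ∑ v, ((freeDegree G A v : ℝ) - freeDegree G B v) ^ 2
      ≤ ∑ v, if G.Adj x v then 1 else 0 := sum_le_sum fun v _ => sq_le v
    _ = G.degree x := by
      rw [sum_boole, ← G.card_neighborFinset_eq_degree, G.neighborFinset_eq_filter]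
    _ ≤ G.maxDegree := mod_cast G.degree_le_maxDegree x

lemma freeDegree_le_card_disjoint_edges {A : Finset V} {v : V} (hv : v ∉ A) :
    freeDegree G A v ≤
      #{e : G.edgeSet | v ∈ (e : Sym2 V) ∧ Disjoint (e : Sym2 V).toFinset A} := by
  refine card_le_card_of_forall_subsingleton (fun u (e : G.edgeSet) => (e : Sym2 V) = s(v, u)) ?_ ?_
  · intro u hu
    obtain ⟨hvu, huA⟩ := (mem_filter.1 hu).2
    refine ⟨⟨s(v, u), hvu⟩, mem_filter.2 ⟨mem_univ _, Sym2.mem_mk_left v u, ?_⟩, rfl⟩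
    simp [disjoint_left, hv, huA]
  · intro e _ u hu u' hu'
    exact Sym2.congr_right.1 (hu.2.symm.trans hu'.2)

/-- If `v` is free and the edge `e` joins it to a free vertex, then `e` was not sampled, and
sampling it in addition would have made it the matching edge at `v`. -/
theorem mul_sampleExpect_freeDegree_le {o : List G.edgeSet} (hn : o.Nodup) (ho : ∀ e, e ∈ o)
    {p : ℝ} (hp : p ∈ Set.Icc 0 1) (A : Finset V) (v : V) :
    p * sampleExpect p (fun L => if v ∈ greedyCover A (sampledList o L) then 0 else
      (freeDegree G (greedyCover A (sampledList o L)) v : ℝ)) ≤ 1 := by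
  let P (L : Finset G.edgeSet) (e : G.edgeSet) : Prop :=
    v ∈ (e : Sym2 V) ∧ Disjoint (e : Sym2 V).toFinset (greedyCover A (sampledList o L))
  let Q (L : Finset G.edgeSet) (e : G.edgeSet) : Prop :=
    v ∈ (e : Sym2 V) ∧ (e : Sym2 V) ∈ greedyAccepted A (sampledList o L)
  have insert_accepted (L e) (h : P L e) : e ∉ L ∧ Q (insert e L) e := by
    have he : e ∉ L := fun he => not_disjoint_greedyCover A (mem_sampledList (ho e) he) h.2
    obtain ⟨l₁, l₂, hL, hinsert⟩ := exists_sampledList_insert hn (ho e) he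
    refine ⟨he, h.1, ?_⟩
    rw [hinsert]
    exact mem_greedyAccepted_of_disjoint_greedyCover (hL ▸ h.2)
  have card_accepted_le_one (L) : (#{e | Q L e} : ℝ) ≤ 1 := by
    refine mod_cast card_le_one.2 fun e he f hf => Subtype.ext ?_
    obtain ⟨hve, hel⟩ := (mem_filter.1 he).2
    obtain ⟨hvf, hfl⟩ := (mem_filter.1 hf).2
    refine (pairwiseDisjoint_greedyAccepted A _).elim hel hfl fun hef => ?_
    exact disjoint_left.1 hef (Sym2.mem_toFinset.2 hve) (Sym2.mem_toFinset.2 hvf)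
  have free_le_card (L) : (if v ∈ greedyCover A (sampledList o L) then 0 else
      (freeDegree G (greedyCover A (sampledList o L)) v : ℝ)) ≤ #{e | P L e} := by
    split_ifs with hv
    · exact Nat.cast_nonneg _
    · exact mod_cast freeDegree_le_card_disjoint_edges hv
  calc _ ≤ p * sampleExpect p (fun L => (#{e | P L e} : ℝ)) :=
        mul_le_mul_of_nonneg_left (sampleExpect_mono hp free_le_card) hp.1
    _ ≤ sampleExpect p (fun L => (#{e | Q L e} : ℝ)) := mul_sampleExpect_card_le hp insert_accepted
    _ ≤ 1 := sampleExpect_le hp card_accepted_le_one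

end FreeDegree

section MachineCover

variable {V κ : Type*} [Fintype V] [DecidableEq V] [DecidableEq κ]

/-- The vertices that the partition `χ` does not assign to the machine `i`. -/
def outside (χ : V → κ) (i : κ) : Finset V := {v | χ v ≠ i}

/-- The vertices that the machine `i` cannot or can no longer match after the greedy algorithm has
processed the list `l`: those of the other parts, and those it has matched. -/
def machineCover (l : List (Sym2 V)) (χ : V → κ) (i : κ) : Finset V := greedyCover (outside χ i) l

lemma differAtMostOne_machineCover_update (l : List (Sym2 V)) (χ : V → κ) (w : V) (j i : κ) :
    DifferAtMostOne (machineCover l χ i) (machineCover l (update χ w j) i) := by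
  refine DifferAtMostOne.greedyCover ⟨w, fun v hv => ?_⟩ l
  simp only [outside, mem_filter, update_of_ne hv]

variable [Fintype κ]

lemma expect_machineCover_eq (l : List (Sym2 V)) (F : Finset V → ℝ) (i j : κ) :
    𝔼 χ : V → κ, F (machineCover l χ i) = 𝔼 χ : V → κ, F (machineCover l χ j) := by
  have relabel (χ : V → κ) : machineCover l (Equiv.swap i j ∘ χ) i = machineCover l χ j := by
    simp only [machineCover, outside, comp_apply, ne_eq, Equiv.swap_apply_eq_iff,
      Equiv.swap_apply_left]
  simp_rw [← relabel]
  exact (Fintype.expect_equiv ((Equiv.refl V).arrowCongr (Equiv.swap i j)) _ _ fun _ => rfl).symm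

theorem expect_sum_sq_freeDegree_sub_le [Nonempty κ] (G : SimpleGraph V) [DecidableRel G.Adj]
    (l : List (Sym2 V)) :
    𝔼 χ : V → κ, ∑ v, ∑ i, ((freeDegree G (machineCover l χ i) v : ℝ) -
      𝔼 χ' : V → κ, (freeDegree G (machineCover l χ' i) v : ℝ)) ^ 2 ≤
        Fintype.card V * (Fintype.card κ * G.maxDegree) := by
  have resample (χ : V → κ) (w : V) (j : κ) :
      ∑ x : V × κ, ((freeDegree G (machineCover l χ x.2) x.1 : ℝ) -
        freeDegree G (machineCover l (update χ w j) x.2) x.1) ^ 2 ≤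
          Fintype.card κ * G.maxDegree := by
    have machine_le (i : κ) := sum_sq_freeDegree_sub_le (G := G)
      (differAtMostOne_machineCover_update l χ w j i)
    rw [Fintype.sum_prod_type_right, ← card_univ, ← nsmul_eq_mul]
    exact sum_le_card_nsmul _ _ _ fun i _ => machine_le i
  have variance_le := sum_expect_sq_sub_expect_le (α := fun _ : V => κ)
    (f := fun (x : V × κ) χ => (freeDegree G (machineCover l χ x.2) x.1 : ℝ)) resample
  rw [Fintype.sum_prod_type] at variance_le
  simp_rw [expect_sum_comm]
  exact variance_le

end MachineCover

section Expectation

variable {V : Type*} [Fintype V] {G : SimpleGraph V} [DecidableRel G.Adj] {k : ℕ}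

lemma sampleProb_mem_Icc : sampleProb G ∈ Set.Icc (0 : ℝ) 1 := by
  refine ⟨Real.rpow_nonneg (Nat.cast_nonneg _) _, ?_⟩
  obtain hΔ | hΔ := G.maxDegree.eq_zero_or_pos
  · rw [sampleProb, hΔ, Nat.cast_zero, Real.zero_rpow (by norm_num)]
    exact zero_le_one
  · exact Real.rpow_le_one_of_one_le_of_nonpos (Nat.one_le_cast.2 hΔ) (by norm_num)

variable [DecidableEq V]

lemma weight_nonneg (ω : Outcome G k) : 0 ≤ weight G k ω :=
  mul_nonneg (mul_nonneg (by positivity) (bernoulliWeight_nonneg sampleProb_mem_Icc _))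
    (prod_nonneg fun _ _ => by positivity)

lemma expectation_eq (f : Outcome G k → ℝ) :
    expectation G k f = 𝔼 π, sampleExpect (sampleProb G) fun L => 𝔼 χ, f (π, L, χ) := by
  have card_orders : Fintype.card (G.edgeSet ≃ Fin (Fintype.card G.edgeSet)) =
      (Fintype.card G.edgeSet).factorial :=
    Fintype.card_equiv (Fintype.equivFin _)
  simp only [expectation, Fintype.sum_prod_type, weight, sampleExpect,
    Fintype.expect_eq_sum_div_card, card_orders, sum_div, mul_sum, Fintype.card_fun,
    Fintype.card_fin, prod_const, card_univ]
  refine sum_congr rfl fun π _ => sum_congr rfl fun L _ => sum_congr rfl fun χ _ => ?_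
  rw [show sampleWeight G L = bernoulliWeight (sampleProb G) L from rfl]
  push_cast
  ring

lemma expectation_mono {f g : Outcome G k → ℝ} (h : ∀ ω, f ω ≤ g ω) :
    expectation G k f ≤ expectation G k g :=
  sum_le_sum fun ω _ => mul_le_mul_of_nonneg_left (h ω) (weight_nonneg ω)

lemma expectation_add (f g : Outcome G k → ℝ) :
    expectation G k (fun ω => f ω + g ω) = expectation G k f + expectation G k g := by
  simp only [expectation, mul_add, sum_add_distrib]

lemma expectation_const_mul (c : ℝ) (f : Outcome G k → ℝ) :
    expectation G k (fun ω => c * f ω) = c * expectation G k f := by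
  simp only [expectation, mul_sum, mul_left_comm]

lemma expectation_sum {ι : Type*} (s : Finset ι) (f : ι → Outcome G k → ℝ) :
    expectation G k (fun ω => ∑ i ∈ s, f i ω) = ∑ i ∈ s, expectation G k (f i) := by
  simp only [expectation, mul_sum]
  exact sum_comm

lemma expectation_le_of_forall_order {f : Outcome G k → ℝ} {c : ℝ}
    (h : ∀ π, sampleExpect (sampleProb G) (fun L => 𝔼 χ, f (π, L, χ)) ≤ c) :
    expectation G k f ≤ c := by
  rw [expectation_eq]
  exact expect_le ⟨Fintype.equivFin _, mem_univ _⟩ fun π _ => h π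

lemma expectation_one [NeZero k] : expectation G k (fun _ => 1) = 1 := by
  have : Nonempty (G.edgeSet ≃ Fin (Fintype.card G.edgeSet)) := ⟨Fintype.equivFin _⟩
  simp_rw [expectation_eq, Fintype.expect_const, sampleExpect_const]

lemma prob_mono {A B : Outcome G k → Prop} (h : ∀ ω, A ω → B ω) : prob G k A ≤ prob G k B := by
  refine sum_le_sum fun ω _ => ?_
  split_ifs with hA hB hB
  exacts [le_rfl, absurd (h ω hA) hB, weight_nonneg ω, le_rfl]

lemma one_sub_expectation_le_prob [NeZero k] {A : Outcome G k → Prop} {Y : Outcome G k → ℝ}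
    (hY : ∀ ω, 0 ≤ Y ω) (hA : ∀ ω, ¬ A ω → 1 ≤ Y ω) : 1 - expectation G k Y ≤ prob G k A := by
  classical
  rw [← expectation_one (G := G) (k := k), expectation, expectation, ← sum_sub_distrib]
  refine sum_le_sum fun ω _ => ?_
  rw [← mul_sub]
  split_ifs with h
  · exact mul_le_of_le_one_right (weight_nonneg ω) (sub_le_self 1 (hY ω))
  · exact mul_nonpos_of_nonneg_of_nonpos (weight_nonneg ω) (sub_nonpos.2 (hA ω h))

end Expectation

section SpreadSum

lemma sum_le_card_mul_add_sqrt {ι : Type*} [Fintype ι] (Y : ι → ℝ) (j : ι) (μ : ℝ) :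
    ∑ i, Y i ≤ Fintype.card ι * (Y j + 2 * √(∑ i, (Y i - μ) ^ 2)) := by
  have deviation_le (i) : |Y i - μ| ≤ √(∑ i, (Y i - μ) ^ 2) :=
    Real.abs_le_sqrt <|
      single_le_sum (f := fun i => (Y i - μ) ^ 2) (fun _ _ => sq_nonneg _) (mem_univ i)
  rw [← nsmul_eq_mul, ← card_univ]
  refine sum_le_card_nsmul _ _ _ fun i _ => ?_
  linarith [(abs_le.1 (deviation_le i)).2, (abs_le.1 (deviation_le j)).1]

lemma one_le_of_lt_sum {ι : Type*} [Fintype ι] {Y : ι → ℝ} {T : ℝ} (hT : 0 < T)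
    (hY : T < ∑ i, Y i) (j : ι) (μ : ℝ) :
    1 ≤ 2 * Fintype.card ι / T * Y j +
      4 * Fintype.card ι ^ 2 / T ^ 2 * ∑ i, (Y i - μ) ^ 2 := by
  set S := ∑ i, (Y i - μ) ^ 2
  set b := 2 * Fintype.card ι * √S / T with hb
  have one_lt : 1 < Fintype.card ι / T * Y j + b := by
    calc 1 < Fintype.card ι * (Y j + 2 * √S) / T :=
          (one_lt_div hT).2 (hY.trans_le (sum_le_card_mul_add_sqrt Y j μ))
      _ = Fintype.card ι / T * Y j + b := by ring
  have sq_b : b ^ 2 = 4 * Fintype.card ι ^ 2 / T ^ 2 * S := by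
    rw [hb, div_pow, mul_pow, Real.sq_sqrt (sum_nonneg fun _ _ => sq_nonneg _)]
    ring
  calc 1 ≤ 2 * (Fintype.card ι / T * Y j) + b ^ 2 := by linarith [sq_nonneg (b - 1)]
    _ = _ := by
        rw [sq_b]
        ring

end SpreadSum

section EdgeOrder

variable {V : Type*} {G : SimpleGraph V} [Fintype G.edgeSet]

/-- All the edges in the order of the permutation `π`. -/
def edgeOrder (π : G.edgeSet ≃ Fin (Fintype.card G.edgeSet)) : List G.edgeSet :=
  List.ofFn π.symm

lemma nodup_edgeOrder (π : G.edgeSet ≃ Fin (Fintype.card G.edgeSet)) : (edgeOrder π).Nodup :=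
  List.nodup_ofFn.2 π.symm.injective

lemma mem_edgeOrder (π : G.edgeSet ≃ Fin (Fintype.card G.edgeSet)) (e : G.edgeSet) :
    e ∈ edgeOrder π :=
  List.mem_ofFn.2 (π.symm.surjective e)

end EdgeOrder

section OutputMatching

variable {V : Type*} [Fintype V] [DecidableEq V] {G : SimpleGraph V} [DecidableRel G.Adj] {k : ℕ}

/-- All sampled edges in the order of `π`, whatever the parts of their endpoints. -/
def sampledOrder (ω : Outcome G k) : List (Sym2 V) := sampledList (edgeOrder ω.1) ω.2.1

lemma partMatching_eq_greedyAccepted (ω : Outcome G k) (i : Fin k) :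
    partMatching ω i = greedyAccepted (outside ω.2.2 i) (sampledOrder ω) := by
  have inside_iff (e : Sym2 V) : Disjoint e.toFinset (outside ω.2.2 i) ↔ ∀ v ∈ e, ω.2.2 v = i := by
    simp [disjoint_left, outside]
  rw [← empty_union (outside ω.2.2 i), greedyAccepted_union_eq_filter, partMatching,
    greedyMatching_eq_greedyAccepted, orderedPartEdges, sampledOrder, sampledList, List.filter_map,
    List.filter_filter]
  congr 2
  refine List.filter_congr fun e _ => ?_
  simp only [partEdges, mem_filter, comp_apply, inside_iff, Bool.decide_and, Bool.and_comm]

lemma notMem_machineCover_iff (ω : Outcome G k) (i : Fin k) (v : V) :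
    v ∉ machineCover (sampledOrder ω) ω.2.2 i ↔
      ω.2.2 v = i ∧ ¬ Covered (outputMatching ω) v := by
  have covered_iff : Covered (outputMatching ω) v ↔
      ∃ i, ∃ e ∈ greedyAccepted (outside ω.2.2 i) (sampledOrder ω), v ∈ e := by
    simp only [Covered, outputMatching, mem_biUnion, mem_univ, true_and,
      partMatching_eq_greedyAccepted]
    exact ⟨fun ⟨e, ⟨i, he⟩, hv⟩ => ⟨i, e, he, hv⟩, fun ⟨i, e, he, hv⟩ => ⟨e, ⟨i, he⟩, hv⟩⟩
  have part_eq {j : Fin k} {e : Sym2 V}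
      (he : e ∈ greedyAccepted (outside ω.2.2 j) (sampledOrder ω)) (hv : v ∈ e) : ω.2.2 v = j := by
    simpa [outside] using
      disjoint_left.1 (disjoint_of_mem_greedyAccepted he) (Sym2.mem_toFinset.2 hv)
  have mem_iff : v ∈ machineCover (sampledOrder ω) ω.2.2 i ↔ ω.2.2 v ≠ i ∨
      ∃ e ∈ greedyAccepted (outside ω.2.2 i) (sampledOrder ω), v ∈ e := by
    simp [machineCover, greedyCover_eq_union_biUnion, outside]
  rw [mem_iff, covered_iff, not_or, not_not]
  refine and_congr_right fun hi => not_congr ⟨fun h => ⟨i, h⟩, ?_⟩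
  rintro ⟨j, e, he, hv⟩
  obtain rfl := hi.symm.trans (part_eq he hv)
  exact ⟨e, he, hv⟩

lemma resDegree_le_sum_freeDegree (ω : Outcome G k) (v : V) :
    resDegree G (outputMatching ω) v ≤
      ∑ i, freeDegree G (machineCover (sampledOrder ω) ω.2.2 i) v := by
  unfold resDegree
  split_ifs
  · exact Nat.zero_le _
  · refine (card_le_card fun u hu => ?_).trans card_biUnion_le
    simp only [mem_filter, mem_univ, true_and] at hu
    obtain ⟨hvu, hu⟩ := hu
    exact mem_biUnion.2 ⟨ω.2.2 u, mem_univ _, mem_filter.2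
      ⟨mem_univ u, hvu, (notMem_machineCover_iff ω _ u).2 ⟨rfl, hu⟩⟩⟩

lemma notMem_machineCover_of_resDegree_pos (ω : Outcome G k) (v : V)
    (h : 0 < resDegree G (outputMatching ω) v) :
    v ∉ machineCover (sampledOrder ω) ω.2.2 (ω.2.2 v) := by
  refine (notMem_machineCover_iff ω _ v).2 ⟨rfl, fun hv => h.ne' ?_⟩
  rw [resDegree, if_pos hv]

end OutputMatching

section ResidualDegree

variable {V : Type*} [Fintype V] [DecidableEq V] {G : SimpleGraph V} [DecidableRel G.Adj] {k : ℕ}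

/-- The number of neighbours of `v` that are left unmatched in its own part if `v` itself is
unmatched, and zero otherwise. -/
def ownFreeDegree (ω : Outcome G k) (v : V) : ℝ :=
  if v ∈ machineCover (sampledOrder ω) ω.2.2 (ω.2.2 v) then 0
  else freeDegree G (machineCover (sampledOrder ω) ω.2.2 (ω.2.2 v)) v

/-- How far the numbers of free neighbours of `v` in the `k` parts are from their expectations over
the random partition. -/
def freeDegreeDeviation (ω : Outcome G k) (v : V) : ℝ :=
  ∑ i, ((freeDegree G (machineCover (sampledOrder ω) ω.2.2 i) v : ℝ) -
    𝔼 χ : V → Fin k, (freeDegree G (machineCover (sampledOrder ω) χ i) v : ℝ)) ^ 2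

lemma ownFreeDegree_nonneg (ω : Outcome G k) (v : V) : 0 ≤ ownFreeDegree ω v := by
  unfold ownFreeDegree
  split_ifs
  exacts [le_rfl, Nat.cast_nonneg _]

lemma freeDegreeDeviation_nonneg (ω : Outcome G k) (v : V) : 0 ≤ freeDegreeDeviation ω v :=
  sum_nonneg fun _ _ => sq_nonneg _

lemma one_le_of_lt_resDegree {T : ℝ} (hT : 0 < T) (ω : Outcome G k) (v : V)
    (h : T < resDegree G (outputMatching ω) v) :
    1 ≤ 2 * k / T * ownFreeDegree ω v + 4 * k ^ 2 / T ^ 2 * freeDegreeDeviation ω v := by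
  have own_eq : ownFreeDegree ω v =
      freeDegree G (machineCover (sampledOrder ω) ω.2.2 (ω.2.2 v)) v :=
    if_neg (notMem_machineCover_of_resDegree_pos ω v (mod_cast hT.trans h))
  have lt_sum : T < ∑ i, (freeDegree G (machineCover (sampledOrder ω) ω.2.2 i) v : ℝ) :=
    h.trans_le (mod_cast resDegree_le_sum_freeDegree ω v)
  have key := one_le_of_lt_sum hT lt_sum (ω.2.2 v) <|
    𝔼 χ : V → Fin k, (freeDegree G (machineCover (sampledOrder ω) χ (ω.2.2 v)) v : ℝ)
  rw [Fintype.card_fin, ← own_eq] at key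
  convert key using 3
  refine sum_congr rfl fun i _ => ?_
  rw [expect_machineCover_eq _ (fun A => (freeDegree G A v : ℝ)) i (ω.2.2 v)]

lemma expectation_sum_ownFreeDegree_le [NeZero k] (hp : 0 < sampleProb G) :
    expectation G k (fun ω => ∑ v, ownFreeDegree ω v) ≤ Fintype.card V / sampleProb G := by
  rw [expectation_sum, div_eq_mul_one_div, ← nsmul_eq_mul, ← card_univ]
  refine sum_le_card_nsmul _ _ _ fun v _ => (le_div_iff₀' hp).2 ?_
  rw [← expectation_const_mul]
  refine expectation_le_of_forall_order fun π => ?_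
  simp_rw [sampleExpect_expect_comm, sampleExpect_const_mul]
  exact expect_le univ_nonempty fun χ _ => mul_sampleExpect_freeDegree_le (nodup_edgeOrder π)
    (mem_edgeOrder π) sampleProb_mem_Icc (outside χ (χ v)) v

lemma expectation_sum_freeDegreeDeviation_le [NeZero k] :
    expectation G k (fun ω => ∑ v, freeDegreeDeviation ω v) ≤
      Fintype.card V * (k * G.maxDegree) := by
  refine expectation_le_of_forall_order fun π => sampleExpect_le sampleProb_mem_Icc fun L => ?_
  have variance_le :=
    expect_sum_sq_freeDegree_sub_le (κ := Fin k) G (sampledList (edgeOrder π) L)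
  rw [Fintype.card_fin] at variance_le
  exact variance_le

theorem expectation_card_lt_resDegree_le [NeZero k] (hp : 0 < sampleProb G) {T : ℝ} (hT : 0 < T) :
    expectation G k (fun ω => (#{v | T < (resDegree G (outputMatching ω) v : ℝ)} : ℝ)) ≤
      2 * k / T * (Fintype.card V / sampleProb G) +
        4 * k ^ 2 / T ^ 2 * (Fintype.card V * (k * G.maxDegree)) := by
  have card_le (ω : Outcome G k) : (#{v | T < (resDegree G (outputMatching ω) v : ℝ)} : ℝ) ≤
      2 * k / T * ∑ v, ownFreeDegree ω v + 4 * k ^ 2 / T ^ 2 * ∑ v, freeDegreeDeviation ω v := by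
    rw [mul_sum, mul_sum, ← sum_add_distrib, ← sum_boole]
    refine sum_le_sum fun v _ => ?_
    split_ifs with h
    · exact one_le_of_lt_resDegree hT ω v h
    · have := ownFreeDegree_nonneg ω v
      have := freeDegreeDeviation_nonneg ω v
      positivity
  calc _ ≤ _ := expectation_mono card_le
    _ = 2 * k / T * expectation G k (fun ω => ∑ v, ownFreeDegree ω v) +
        4 * k ^ 2 / T ^ 2 * expectation G k (fun ω => ∑ v, freeDegreeDeviation ω v) := by
      rw [expectation_add, expectation_const_mul, expectation_const_mul]
    _ ≤ _ := by
      gcongr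
      exacts [expectation_sum_ownFreeDegree_le hp, expectation_sum_freeDegreeDeviation_le]

end ResidualDegree

section Space

lemma wordsOf_add {V : Type*} (D D' : Multiset (Datum V)) :
    wordsOf (D + D') = wordsOf D + wordsOf D' := by
  simp only [wordsOf, Multiset.map_add, Multiset.sum_add]

lemma wordsOf_map {V β : Type*} {f : β → Datum V} {c : ℕ} (hf : ∀ x, (f x).words = c)
    (s : Finset β) : wordsOf (s.val.map f) = #s * c := by
  simp only [wordsOf, Multiset.map_map, comp_def, hf, Multiset.map_const', Multiset.sum_replicate,
    card_val, smul_eq_mul]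

variable {V : Type*} [Fintype V] {G : SimpleGraph V} [DecidableRel G.Adj] {k : ℕ}

lemma sum_card_partVerts (ω : Outcome G k) : ∑ i, #(partVerts ω i) = Fintype.card V :=
  (card_eq_sum_card_fiberwise fun _ _ => mem_coe.2 (mem_univ _)).symm

variable [DecidableEq V]

lemma card_partMatching_le (ω : Outcome G k) (i : Fin k) :
    #(partMatching ω i) ≤ #(partEdges ω i) := by
  refine (card_le_card fun e he => ?_).trans (card_image_le (f := Subtype.val))
  rw [partMatching, greedyMatching_eq_greedyAccepted] at he
  obtain ⟨f, hf, rfl⟩ := List.mem_map.1 (mem_of_mem_greedyAccepted he)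
  exact mem_image_of_mem _ (of_decide_eq_true (List.mem_filter.1 hf).2)

lemma machineSpace_le (ω : Outcome G k) (i : Fin k) :
    machineSpace ω i ≤ #(partVerts ω i) + 5 * #(partEdges ω i) := by
  have matching_le := card_partMatching_le ω i
  rw [machineSpace, machineMemory, received, wordsOf_add, wordsOf_add,
    wordsOf_map (c := 1) fun _ => rfl, wordsOf_map (c := 3) fun _ => rfl,
    wordsOf_map (c := 2) fun _ => rfl]
  omega

lemma sum_card_partEdges_le (ω : Outcome G k) : ∑ i, #(partEdges ω i) ≤ #ω.2.1 := by
  rw [card_eq_sum_card_fiberwise (f := fun e : G.edgeSet => ω.2.2 (e : Sym2 V).out.1)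
    (t := univ) fun _ _ => mem_coe.2 (mem_univ _)]
  refine sum_le_sum fun i _ => card_le_card fun e he => ?_
  obtain ⟨heL, hei⟩ := mem_filter.1 he
  exact mem_filter.2 ⟨heL, hei _ (Sym2.out_fst_mem _)⟩

lemma totalSpace_le (ω : Outcome G k) : totalSpace ω ≤ 3 * Fintype.card V + 8 * #ω.2.1 := by
  have machines_le : ∑ i, machineSpace ω i ≤ Fintype.card V + 5 * #ω.2.1 :=
    calc ∑ i, machineSpace ω i
        ≤ ∑ i, (#(partVerts ω i) + 5 * #(partEdges ω i)) :=
          sum_le_sum fun i _ => machineSpace_le ω i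
      _ = Fintype.card V + 5 * ∑ i, #(partEdges ω i) := by
          rw [sum_add_distrib, sum_card_partVerts, mul_sum]
      _ ≤ Fintype.card V + 5 * #ω.2.1 := by
          gcongr
          exact sum_card_partEdges_le ω
  rw [totalSpace, randomizationData, wordsOf_add, wordsOf_map (c := 2) fun _ => rfl,
    wordsOf_map (c := 3) fun _ => rfl, card_univ]
  omega

end Space

section SpaceTails

lemma sampleExpect_exp_card_filter_le {ε : Type*} [Fintype ε] [DecidableEq ε] {p t : ℝ}
    (hp : p ∈ Set.Icc 0 1) (ht : t ∈ Set.Icc 0 1) (P : ε → Prop) [DecidablePred P] :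
    sampleExpect p (fun L => Real.exp (t * #{e ∈ L | P e})) ≤
      Real.exp (2 * p * (t * #{e | P e})) := by
  have indicator_mem (e : ε) : t * (if P e then 1 else 0) ∈ Set.Icc 0 1 := by
    split_ifs
    · rwa [mul_one]
    · simp
  simpa only [← mul_sum, sum_boole] using sampleExpect_exp_sum_le hp indicator_mem

section PartitionLoad

variable {V κ : Type*} [Fintype V] [DecidableEq V] [Fintype κ] [DecidableEq κ]

lemma sum_filter_mem_load_le (G : SimpleGraph V) [DecidableRel G.Adj] {a b : ℝ} (hb : 0 ≤ b)
    (hab : a + b * G.maxDegree ≤ 1) (w : V) :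
    ∑ x with w ∈ Sum.elim singleton (fun e : G.edgeSet => (e : Sym2 V).toFinset) x,
      Sum.elim (fun _ : V => a) (fun _ : G.edgeSet => b) x ≤ 1 := by
  have edges_at : #{e : G.edgeSet | w ∈ (e : Sym2 V)} ≤ G.maxDegree := by
    refine le_trans ?_ (G.degree_le_maxDegree w)
    rw [← G.card_incidenceFinset_eq_degree]
    refine card_le_card_of_injOn Subtype.val (fun e he => ?_) Subtype.val_injective.injOn
    exact (G.mem_incidenceFinset w e).2 ⟨e.2, (mem_filter.1 he).2⟩
  rw [sum_filter, Fintype.sum_sum_type]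
  simp only [Sum.elim_inl, Sum.elim_inr, mem_singleton, Sym2.mem_toFinset, sum_ite_eq, mem_univ,
    if_true, ← sum_filter, sum_const, nsmul_eq_mul, mul_comm _ b]
  exact le_trans (by gcongr) hab

theorem expect_exp_load_le (G : SimpleGraph V) [DecidableRel G.Adj] {a b : ℝ} (ha : 0 ≤ a)
    (hb : 0 ≤ b) (hab : a + b * G.maxDegree ≤ 1) (hκ : 2 ≤ Fintype.card κ) (i : κ) :
    𝔼 χ : V → κ, Real.exp
      (a * #{v | χ v = i} + b * #{e : G.edgeSet | ∀ v ∈ (e : Sym2 V), χ v = i}) ≤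
        Real.exp (a * (Fintype.card V * (2 / Fintype.card κ)) +
          b * (Fintype.card G.edgeSet * (2 / Fintype.card κ) ^ 2)) := by
  have : Nonempty κ := ⟨i⟩
  have two_mul_expect : 2 * 𝔼 j : κ, (if j = i then 1 else 0 : ℝ) = 2 / Fintype.card κ := by
    rw [Fintype.expect_eq_sum_div_card, sum_ite_eq', if_pos (mem_univ i), mul_one_div]
  have card_endpoints (e : G.edgeSet) : #(e : Sym2 V).toFinset = 2 :=
    Sym2.card_toFinset_of_not_isDiag _ (G.not_isDiag_of_mem_edgeSet e.2)
  have bound := expect_exp_sum_mul_prod_le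
    (a := Sum.elim (fun _ : V => a) (fun _ : G.edgeSet => b))
    (S := Sum.elim singleton fun e : G.edgeSet => (e : Sym2 V).toFinset)
    (α := fun _ => κ) (X := fun _ j => if j = i then 1 else 0)
    (by rintro (_ | _) <;> assumption) (sum_filter_mem_load_le G hb hab)
    (fun _ j => by split_ifs <;> simp) (fun _ => by
      rw [two_mul_expect]
      exact div_le_one_of_le₀ (mod_cast hκ) (Nat.cast_nonneg _))
  simpa only [two_mul_expect, Fintype.sum_sum_type, Sum.elim_inl, Sum.elim_inr, prod_singleton,
    card_singleton, pow_one, mem_singleton, forall_eq, prod_boole, prod_const, card_endpoints,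
    ← mul_sum, sum_boole, sum_const, card_univ, nsmul_eq_mul, Sym2.mem_toFinset] using bound

end PartitionLoad

variable {V : Type*} [Fintype V] [DecidableEq V] {G : SimpleGraph V} [DecidableRel G.Adj] {k : ℕ}

theorem expectation_exp_machineSpace_le (hk : 2 ≤ k) {s : ℝ} (hs : 0 ≤ s) (hs5 : 5 * s ≤ 1)
    (hsΔ : s + 2 * sampleProb G * (5 * s) * G.maxDegree ≤ 1) (i : Fin k) :
    expectation G k (fun ω => Real.exp (s * machineSpace ω i)) ≤
      Real.exp (s * (Fintype.card V * (2 / k)) +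
        2 * sampleProb G * (5 * s) * (#G.edgeFinset * (2 / k) ^ 2)) := by
  have hp : sampleProb G ∈ Set.Icc 0 1 := sampleProb_mem_Icc
  have coeff_nonneg : 0 ≤ 2 * sampleProb G * (5 * s) := by
    have := hp.1
    positivity
  have space_le (ω : Outcome G k) : Real.exp (s * machineSpace ω i) ≤
      Real.exp (s * #{v | ω.2.2 v = i}) *
        Real.exp (5 * s * #{e ∈ ω.2.1 | ∀ v ∈ e.1, ω.2.2 v = i}) := by
    rw [← Real.exp_add, mul_comm 5, mul_assoc, ← mul_add]
    gcongr
    convert (Nat.cast_le (α := ℝ)).2 (machineSpace_le ω i)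
    push_cast [partVerts, partEdges]
    congr
  refine (expectation_mono space_le).trans (expectation_le_of_forall_order fun π => ?_)
  simp_rw [sampleExpect_expect_comm, sampleExpect_const_mul]
  calc _ ≤ 𝔼 χ : V → Fin k, Real.exp (s * #{v | χ v = i} +
        2 * sampleProb G * (5 * s) * #{e : G.edgeSet | ∀ v ∈ e.1, χ v = i}) := by
        refine expect_le_expect fun χ _ => ?_
        rw [Real.exp_add, mul_assoc _ (5 * s)]
        gcongr
        exact sampleExpect_exp_card_filter_le hp ⟨by positivity, hs5⟩ _
    _ ≤ _ := expect_exp_load_le G hs coeff_nonneg hsΔ (by rwa [Fintype.card_fin]) i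
    _ = _ := by rw [Fintype.card_fin, SimpleGraph.edgeFinset_card]

lemma one_sub_sum_le_prob_forall_le [NeZero k] {ι : Type*} [Fintype ι] (Y : ι → Outcome G k → ℝ)
    {s : ℝ} (hs : 0 ≤ s) (t : ℝ) :
    1 - ∑ i, Real.exp (-(s * t)) * expectation G k (fun ω => Real.exp (s * Y i ω)) ≤
      prob G k fun ω => ∀ i, Y i ω ≤ t := by
  simp_rw [← expectation_const_mul, ← expectation_sum, ← Real.exp_add]
  refine one_sub_expectation_le_prob (fun _ => sum_nonneg fun _ _ => (Real.exp_pos _).le)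
    fun ω h => ?_
  push Not at h
  obtain ⟨i, hi⟩ := h
  calc 1 ≤ Real.exp (-(s * t) + s * Y i ω) := by
        rw [Real.one_le_exp_iff]
        nlinarith
    _ ≤ _ := single_le_sum (f := fun i => Real.exp (-(s * t) + s * Y i ω))
        (fun _ _ => (Real.exp_pos _).le) (mem_univ i)

lemma one_sub_exp_le_prob_card_sample_le [NeZero k] (t : ℝ) :
    1 - Real.exp (-t) ≤
      prob G k fun ω => (#ω.2.1 : ℝ) ≤ 2 * sampleProb G * #G.edgeFinset + t := by
  set μ := 2 * sampleProb G * #G.edgeFinset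
  have moment_le : expectation G k (fun ω => Real.exp #ω.2.1) ≤ Real.exp μ := by
    refine expectation_le_of_forall_order fun π => ?_
    simp_rw [Fintype.expect_const]
    simpa [μ, SimpleGraph.edgeFinset_card] using sampleExpect_exp_card_filter_le sampleProb_mem_Icc
      (Set.right_mem_Icc.2 zero_le_one) fun _ : G.edgeSet => True
  calc 1 - Real.exp (-t)
      ≤ 1 - Real.exp (-(μ + t)) * expectation G k (fun ω => Real.exp #ω.2.1) := by
        rw [neg_add_rev, Real.exp_add, mul_assoc]
        gcongr
        refine mul_le_of_le_one_right (Real.exp_pos _).le ?_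
        rwa [Real.exp_neg, inv_mul_le_one₀ (Real.exp_pos _)]
    _ ≤ _ := by
        rw [← expectation_const_mul]
        simp_rw [← Real.exp_add]
        refine one_sub_expectation_le_prob (fun _ => (Real.exp_pos _).le) fun ω h => ?_
        rw [Real.one_le_exp_iff]
        linarith

end SpaceTails

section ParameterChoice

lemma natCast_mem_Icc_half_two_mul {k : ℕ} {x : ℝ} (hx : 1 ≤ x) (hk : |(k : ℝ) - x| < 1) :
    (k : ℝ) ∈ Set.Icc (x / 2) (2 * x) := by
  have := abs_lt.1 hk
  have one_le : (1 : ℝ) ≤ k := Nat.one_le_cast.2 (Nat.cast_pos.1 (by linarith : (0 : ℝ) < k))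
  constructor <;> linarith

variable {V : Type*} [Fintype V] {G : SimpleGraph V} [DecidableRel G.Adj] {k : ℕ}

lemma maxDegree_lt_card_of_pos (hΔ : 0 < G.maxDegree) : G.maxDegree < Fintype.card V := by
  have : Nonempty V := not_isEmpty_iff.1 fun _ => by simp [SimpleGraph.maxDegree] at hΔ
  exact G.maxDegree_lt_card_verts

lemma two_mul_card_edgeFinset_le : 2 * #G.edgeFinset ≤ Fintype.card V * G.maxDegree := by
  rw [← G.sum_degrees_eq_twice_card_edges, ← smul_eq_mul, ← card_univ]
  exact sum_le_card_nsmul _ _ _ fun v _ => G.degree_le_maxDegree v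

lemma sampleProb_mul_maxDegree (hΔ : 0 < G.maxDegree) :
    sampleProb G * G.maxDegree = (G.maxDegree : ℝ) ^ (0.15 : ℝ) := by
  rw [sampleProb, ← Real.rpow_add_one (by positivity)]
  norm_num

lemma two_mul_sampleProb_mul_card_edgeFinset_le (hΔ : 0 < G.maxDegree) :
    2 * (sampleProb G * #G.edgeFinset) ≤ Fintype.card V * (G.maxDegree : ℝ) ^ (0.15 : ℝ) := by
  have := sampleProb_mem_Icc (G := G).1
  calc 2 * (sampleProb G * #G.edgeFinset) = sampleProb G * (2 * #G.edgeFinset : ℕ) := by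
        push_cast
        ring
    _ ≤ sampleProb G * (Fintype.card V * G.maxDegree : ℕ) := by
        gcongr ?_ * (?_ : ℕ)
        exact two_mul_card_edgeFinset_le
    _ = _ := by
        rw [← sampleProb_mul_maxDegree hΔ]
        push_cast
        ring

lemma sixteen_mul_sampleProb_mul_card_edgeFinset_le (hΔ : 1 ≤ G.maxDegree) :
    16 * (sampleProb G * #G.edgeFinset) ≤
      128 * Fintype.card V + #G.edgeFinset / (G.maxDegree : ℝ) ^ (0.01 : ℝ) := by
  have pm_le := two_mul_sampleProb_mul_card_edgeFinset_le hΔ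
  set d : ℝ := (G.maxDegree : ℝ) with hd
  have one_le_d : 1 ≤ d := Nat.one_le_cast.2 hΔ
  have d_pos : 0 < d := by positivity
  rcases le_total 16 (d ^ (0.84 : ℝ)) with d_large | d_small
  · have p_le : 16 * sampleProb G ≤ (d ^ (0.01 : ℝ))⁻¹ :=
      calc 16 * sampleProb G ≤ d ^ (0.84 : ℝ) * d ^ (-0.85 : ℝ) := by
            rw [sampleProb, ← hd]
            gcongr
        _ = (d ^ (0.01 : ℝ))⁻¹ := by
            rw [← Real.rpow_add d_pos, ← Real.rpow_neg d_pos.le]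
            norm_num
    calc 16 * (sampleProb G * #G.edgeFinset) = 16 * sampleProb G * #G.edgeFinset := by ring
      _ ≤ (d ^ (0.01 : ℝ))⁻¹ * #G.edgeFinset := by gcongr
      _ = #G.edgeFinset / d ^ (0.01 : ℝ) := by ring
      _ ≤ _ := le_add_of_nonneg_left (by positivity)
  · calc 16 * (sampleProb G * #G.edgeFinset) = 8 * (2 * (sampleProb G * #G.edgeFinset)) := by ring
      _ ≤ 8 * (Fintype.card V * 16) := by
          have pow_le : d ^ (0.15 : ℝ) ≤ 16 := le_trans (by gcongr; norm_num) d_small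
          gcongr 8 * ?_
          exact pm_le.trans (by gcongr)
      _ = 128 * Fintype.card V := by ring
      _ ≤ _ := le_add_of_nonneg_right (by positivity)

lemma mean_machineSpace_le (hΔ : 1 ≤ G.maxDegree) (hk : (G.maxDegree : ℝ) ^ (0.1 : ℝ) / 2 ≤ k)
    (hΔ' : 168 ≤ (G.maxDegree : ℝ) ^ (0.04 : ℝ)) :
    Fintype.card V * (2 / k) + 10 * (sampleProb G * #G.edgeFinset) * (2 / (k : ℝ)) ^ 2 ≤
      Fintype.card V / (G.maxDegree : ℝ) ^ (0.01 : ℝ) / 2 := by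
  have pm_le := two_mul_sampleProb_mul_card_edgeFinset_le hΔ
  set d : ℝ := (G.maxDegree : ℝ)
  have one_le_d : 1 ≤ d := Nat.one_le_cast.2 hΔ
  have d_pos : 0 < d := by positivity
  have two_div_k_le : 2 / (k : ℝ) ≤ 4 * d ^ (-0.1 : ℝ) :=
    calc 2 / (k : ℝ) ≤ 2 / (d ^ (0.1 : ℝ) / 2) := by gcongr
      _ = 4 * d ^ (-0.1 : ℝ) := by
        rw [Real.rpow_neg d_pos.le]
        ring
  calc _ = Fintype.card V * (2 / k) +
        5 * (2 * (sampleProb G * #G.edgeFinset)) * (2 / (k : ℝ)) ^ 2 := by ring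
    _ ≤ Fintype.card V * (4 * d ^ (-0.1 : ℝ)) +
        5 * (Fintype.card V * d ^ (0.15 : ℝ)) * (4 * d ^ (-0.1 : ℝ)) ^ 2 := by
        gcongr
    _ = Fintype.card V * (4 * d ^ (-0.1 : ℝ) + 80 * d ^ (0.15 + -0.1 * 2 : ℝ)) := by
        rw [Real.rpow_add d_pos, Real.rpow_mul d_pos.le, Real.rpow_ofNat]
        ring
    _ ≤ Fintype.card V * (4 * d ^ (-0.05 : ℝ) + 80 * d ^ (-0.05 : ℝ)) := by
        gcongr <;> norm_num
    _ = Fintype.card V * (168 * d ^ (-0.05 : ℝ)) / 2 := by ring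
    _ ≤ Fintype.card V * (d ^ (0.04 : ℝ) * d ^ (-0.05 : ℝ)) / 2 := by gcongr
    _ = _ := by
        rw [← Real.rpow_add d_pos, div_eq_mul_inv (_ : ℝ) (d ^ _), ← Real.rpow_neg d_pos.le]
        norm_num

variable [DecidableEq V]

theorem expectation_highResDegreeCount_le (hΔ : 1 ≤ G.maxDegree)
    (hk : |(k : ℝ) - (G.maxDegree : ℝ) ^ (0.1 : ℝ)| < 1) :
    expectation G k (fun ω => (highResDegreeCount ω : ℝ)) ≤
      36 * (Fintype.card V / (G.maxDegree : ℝ) ^ (0.03 : ℝ)) := by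
  set d : ℝ := (G.maxDegree : ℝ)
  have one_le_d : 1 ≤ d := Nat.one_le_cast.2 hΔ
  have d_pos : 0 < d := by positivity
  obtain ⟨k_ge, k_le⟩ := natCast_mem_Icc_half_two_mul (Real.one_le_rpow one_le_d (by norm_num)) hk
  have k_pos : (0 : ℝ) < k := lt_of_lt_of_le (by positivity) k_ge
  have : NeZero k := ⟨(Nat.cast_pos.1 k_pos).ne'⟩
  calc expectation G k (fun ω => (highResDegreeCount ω : ℝ))
      ≤ 2 * k / d ^ (0.99 : ℝ) * (Fintype.card V / d ^ (-0.85 : ℝ)) +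
          4 * k ^ 2 / (d ^ (0.99 : ℝ)) ^ 2 * (Fintype.card V * (k * d)) := by
        convert expectation_card_lt_resDegree_le (k := k) (Real.rpow_pos_of_pos d_pos _)
          (Real.rpow_pos_of_pos d_pos 0.99)
        · rw [highResDegreeCount]
        · rfl
    _ ≤ 2 * (2 * d ^ (0.1 : ℝ)) / d ^ (0.99 : ℝ) * (Fintype.card V / d ^ (-0.85 : ℝ)) +
          4 * (2 * d ^ (0.1 : ℝ)) ^ 2 / (d ^ (0.99 : ℝ)) ^ 2 *
            (Fintype.card V * (2 * d ^ (0.1 : ℝ) * d)) := by gcongr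
    _ = 4 * Fintype.card V * d ^ (0.1 - 0.99 - -0.85 : ℝ) +
          32 * Fintype.card V * d ^ (0.1 * 3 + 1 - 0.99 * 2 : ℝ) := by
        simp only [Real.rpow_sub d_pos, Real.rpow_add d_pos, Real.rpow_mul d_pos.le,
          Real.rpow_ofNat, Real.rpow_one]
        ring
    _ ≤ 4 * Fintype.card V * d ^ (-0.03 : ℝ) + 32 * Fintype.card V * d ^ (-0.03 : ℝ) := by
        gcongr <;> norm_num
    _ = _ := by
        rw [Real.rpow_neg d_pos.le]
        ring

theorem one_sub_exp_le_prob_totalSpace_le [NeZero k] (hΔ : 1 ≤ G.maxDegree) :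
    1 - Real.exp (-(Fintype.card V : ℝ) ^ (0.01 : ℝ)) ≤
      prob G k fun ω => (totalSpace ω : ℝ) ≤
        139 * Fintype.card V + #G.edgeFinset / (G.maxDegree : ℝ) ^ (0.01 : ℝ) := by
  have one_le_n : (1 : ℝ) ≤ Fintype.card V := mod_cast hΔ.trans (maxDegree_lt_card_of_pos hΔ).le
  calc 1 - Real.exp (-(Fintype.card V : ℝ) ^ (0.01 : ℝ))
      ≤ 1 - Real.exp (-(Fintype.card V : ℝ)) := by
        gcongr
        exact Real.rpow_le_self_of_one_le one_le_n (by norm_num)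
    _ ≤ prob G k fun ω => (#ω.2.1 : ℝ) ≤ 2 * sampleProb G * #G.edgeFinset + Fintype.card V :=
        one_sub_exp_le_prob_card_sample_le _
    _ ≤ _ := prob_mono fun ω card_le => by
        have space_le : (totalSpace ω : ℝ) ≤ 3 * Fintype.card V + 8 * #ω.2.1 :=
          mod_cast totalSpace_le ω
        linarith [sixteen_mul_sampleProb_mul_card_edgeFinset_le hΔ]

lemma rpow_div_le_mul_div {d n : ℝ} (hd : 0 < d) (hdn : d ≤ n) :
    n ^ (0.84 : ℝ) / 22 ≤ d ^ (-0.15 : ℝ) / 11 * (n / d ^ (0.01 : ℝ)) / 2 := by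
  have n_pos : 0 < n := hd.trans_le hdn
  calc n ^ (0.84 : ℝ) / 22 = n * n ^ (-0.16 : ℝ) / 22 := by
        rw [mul_comm, ← Real.rpow_add_one n_pos.ne']
        norm_num
    _ ≤ n * d ^ (-0.16 : ℝ) / 22 := by
        gcongr ?_ * ?_ / _
        exact Real.rpow_le_rpow_of_nonpos hd hdn (by norm_num)
    _ = _ := by
        rw [show (-0.16 : ℝ) = -0.15 - 0.01 by norm_num, Real.rpow_sub hd]
        ring

/- The `11` comes from `1 + 10 * (p * Δ) ≤ 11 * (p * Δ)`, which makes the coefficients at each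
vertex sum to at most `1`. -/
lemma exp_mul_expectation_exp_machineSpace_le (hΔ : 1 ≤ G.maxDegree) (hk : 2 ≤ k)
    (hk' : (G.maxDegree : ℝ) ^ (0.1 : ℝ) / 2 ≤ k) (hΔ' : 168 ≤ (G.maxDegree : ℝ) ^ (0.04 : ℝ))
    {s t : ℝ} (hs : s = (G.maxDegree : ℝ) ^ (-0.15 : ℝ) / 11)
    (ht : t = Fintype.card V / (G.maxDegree : ℝ) ^ (0.01 : ℝ)) (i : Fin k) :
    Real.exp (-(s * t)) * expectation G k (fun ω => Real.exp (s * machineSpace ω i)) ≤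
      Real.exp (-((Fintype.card V : ℝ) ^ (0.84 : ℝ) / 22)) := by
  have mean_le := mean_machineSpace_le hΔ hk' hΔ'
  have d_le_n : (G.maxDegree : ℝ) ≤ Fintype.card V := mod_cast (maxDegree_lt_card_of_pos hΔ).le
  have p_mul_d := sampleProb_mul_maxDegree hΔ
  rw [← ht] at mean_le
  set d : ℝ := (G.maxDegree : ℝ) with hd
  have one_le_d : 1 ≤ d := Nat.one_le_cast.2 hΔ
  have d_pos : 0 < d := by positivity
  have gap := rpow_div_le_mul_div d_pos d_le_n
  rw [← hs, ← ht] at gap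
  have s_nonneg : 0 ≤ s := by rw [hs]; positivity
  have s_le : 11 * s ≤ 1 := by
    rw [hs, mul_div_cancel₀ _ (by norm_num)]
    exact Real.rpow_le_one_of_one_le_of_nonpos one_le_d (by norm_num)
  have eleven_mul : sampleProb G * d * (11 * s) = 1 := by
    rw [p_mul_d, hs, mul_div_cancel₀ _ (by norm_num), ← Real.rpow_add d_pos]
    norm_num
  have moment_le := expectation_exp_machineSpace_le (G := G) hk s_nonneg (by linarith)
    (by rw [← hd]; linarith) i
  calc _ ≤ Real.exp (-(s * t)) * Real.exp (s * (t / 2)) := by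
        gcongr
        refine moment_le.trans (Real.exp_le_exp.2 ?_)
        linarith [mul_le_mul_of_nonneg_left mean_le s_nonneg]
    _ ≤ _ := by
        rw [← Real.exp_add]
        gcongr
        linarith

theorem one_sub_exp_le_prob_machineSpace_le (hΔ : 1 ≤ G.maxDegree)
    (hk : |(k : ℝ) - (G.maxDegree : ℝ) ^ (0.1 : ℝ)| < 1)
    (hΔ' : 168 ≤ (G.maxDegree : ℝ) ^ (0.04 : ℝ))
    (hn : 2 * (Fintype.card V : ℝ) * Real.exp (-((Fintype.card V : ℝ) ^ (0.84 : ℝ) / 22)) ≤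
      Real.exp (-(Fintype.card V : ℝ) ^ (0.01 : ℝ))) :
    1 - Real.exp (-(Fintype.card V : ℝ) ^ (0.01 : ℝ)) ≤
      prob G k fun ω => ∀ i : Fin k,
        (machineSpace ω i : ℝ) ≤ Fintype.card V / (G.maxDegree : ℝ) ^ (0.01 : ℝ) := by
  have one_le_d : (1 : ℝ) ≤ G.maxDegree := mod_cast hΔ
  have d_le_n : (G.maxDegree : ℝ) ≤ Fintype.card V := mod_cast (maxDegree_lt_card_of_pos hΔ).le
  obtain ⟨k_ge, k_le⟩ := natCast_mem_Icc_half_two_mul (Real.one_le_rpow one_le_d (by norm_num)) hk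
  have k_le_n : (k : ℝ) ≤ 2 * Fintype.card V := by
    linarith [Real.rpow_le_self_of_one_le one_le_d (show (0.1 : ℝ) ≤ 1 by norm_num)]
  have two_le_k : 2 ≤ k := by
    have pow_mono : (G.maxDegree : ℝ) ^ (0.04 : ℝ) ≤ (G.maxDegree : ℝ) ^ (0.1 : ℝ) := by
      gcongr
      norm_num
    exact_mod_cast (by linarith : (2 : ℝ) ≤ k)
  have : NeZero k := ⟨by omega⟩
  refine le_trans ?_ (one_sub_sum_le_prob_forall_le (fun i ω => (machineSpace ω i : ℝ))
    (s := (G.maxDegree : ℝ) ^ (-0.15 : ℝ) / 11) (by positivity) _)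
  gcongr
  calc _ ≤ ∑ _i : Fin k, Real.exp (-((Fintype.card V : ℝ) ^ (0.84 : ℝ) / 22)) :=
        sum_le_sum fun i _ =>
          exp_mul_expectation_exp_machineSpace_le hΔ two_le_k k_ge hΔ' rfl rfl i
    _ = k * Real.exp (-((Fintype.card V : ℝ) ^ (0.84 : ℝ) / 22)) := by
        rw [sum_const, card_univ, Fintype.card_fin, nsmul_eq_mul]
    _ ≤ _ := le_trans (by gcongr) hn

lemma eventually_two_mul_exp_neg_rpow_le {a b c : ℝ} (hc : 0 < c) (hba : b < a) (ha : 0 < a) :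
    ∀ᶠ x : ℝ in Filter.atTop, 2 * x * Real.exp (-(x ^ a / c)) ≤ Real.exp (-x ^ b) := by
  have log_le := (isLittleO_log_rpow_atTop ha).def (show 0 < 1 / (4 * c) by positivity)
  have gap := (tendsto_rpow_atTop (sub_pos.2 hba)).eventually_ge_atTop (2 * c)
  filter_upwards [log_le, gap, Filter.eventually_ge_atTop 2] with x log_le gap hx
  have x_pos : 0 < x := by linarith
  rw [Real.norm_of_nonneg (Real.log_nonneg (by linarith)), Real.norm_of_nonneg (by positivity),
    div_mul_eq_mul_div, one_mul, le_div_iff₀ (by positivity)] at log_le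
  have pow_le : 2 * c * x ^ b ≤ x ^ a :=
    calc 2 * c * x ^ b ≤ x ^ (a - b) * x ^ b := by gcongr
      _ = x ^ a := by rw [← Real.rpow_add x_pos, sub_add_cancel]
  have log_two_le : Real.log 2 ≤ Real.log x := Real.log_le_log two_pos hx
  rw [← Real.exp_log (show 0 < 2 * x by positivity), Real.log_mul two_ne_zero x_pos.ne',
    ← Real.exp_add, Real.exp_le_exp, ← sub_eq_add_neg, sub_le_comm, sub_neg_eq_add,
    le_div_iff₀ hc]
  nlinarith

lemma exists_degree_threshold : ∃ Δ₀ : ℕ, ∀ d n : ℕ, Δ₀ ≤ d → d ≤ n →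
    168 ≤ (d : ℝ) ^ (0.04 : ℝ) ∧
      2 * (n : ℝ) * Real.exp (-((n : ℝ) ^ (0.84 : ℝ) / 22)) ≤ Real.exp (-(n : ℝ) ^ (0.01 : ℝ)) := by
  have large := (tendsto_rpow_atTop (show (0 : ℝ) < 0.04 by norm_num)).eventually_ge_atTop 168
  have tail := eventually_two_mul_exp_neg_rpow_le (a := 0.84) (b := 0.01) (c := 22)
    (by norm_num) (by norm_num) (by norm_num)
  obtain ⟨Δ₀, hΔ₀⟩ := Filter.eventually_atTop.1 <|
    (tendsto_natCast_atTop_atTop (R := ℝ)).eventually (large.and tail)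
  exact ⟨Δ₀, fun d n hd hdn => ⟨(hΔ₀ d hd).1, (hΔ₀ n (hd.trans hdn)).2⟩⟩

end ParameterChoice

end

end NearMaximal

theorem mainTheorem4 :
    ∃ c : ℝ, 0 < c ∧ ∃ C : ℝ, 0 < C ∧ ∃ Δ₀ : ℕ,
      ∀ (V : Type*) [Fintype V] [DecidableEq V] (G : SimpleGraph V) [DecidableRel G.Adj] (k : ℕ),
        1 ≤ G.maxDegree →
        |(k : ℝ) - (G.maxDegree : ℝ) ^ (0.1 : ℝ)| < 1 →
        (Δ₀ ≤ G.maxDegree →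
          1 - Real.exp (-((Fintype.card V : ℝ) ^ c)) ≤
            prob G k fun ω => ∀ i : Fin k,
              (machineSpace ω i : ℝ) ≤ (Fintype.card V : ℝ) / (G.maxDegree : ℝ) ^ c) ∧
        (1 - Real.exp (-((Fintype.card V : ℝ) ^ c)) ≤
            prob G k fun ω =>
              (totalSpace ω : ℝ) ≤ C * (Fintype.card V : ℝ) +
                (G.edgeFinset.card : ℝ) / (G.maxDegree : ℝ) ^ c) ∧
        expectation G k (fun ω => (highResDegreeCount ω : ℝ)) ≤
          C * ((Fintype.card V : ℝ) / (G.maxDegree : ℝ) ^ (0.03 : ℝ)) := by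
  obtain ⟨Δ₀, hΔ₀⟩ := exists_degree_threshold
  refine ⟨0.01, by norm_num, 139, by norm_num, Δ₀, fun V _ _ G _ k hΔ hk => ?_⟩
  have k_ge := (natCast_mem_Icc_half_two_mul
    (Real.one_le_rpow (Nat.one_le_cast.2 hΔ) (by norm_num)) hk).1
  have : NeZero k := ⟨(Nat.cast_pos.1 (k_ge.trans_lt' (by positivity))).ne'⟩
  refine ⟨fun hΔ₀_le => ?_, one_sub_exp_le_prob_totalSpace_le hΔ, ?_⟩
  · obtain ⟨degree_large, tail_le⟩ := hΔ₀ _ _ hΔ₀_le (maxDegree_lt_card_of_pos hΔ).le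
    exact one_sub_exp_le_prob_machineSpace_le hΔ hk degree_large tail_le
  · refine (expectation_highResDegreeCount_le hΔ hk).trans ?_
    gcongr
    norm_num
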